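/- All graphs are finite and simple; $\chi(G)$ and $\omega(G)$ denote the chromatic number and the clique number of $G$. For a graph $G$ and an integer $\rho\ge 1$, let $\chi^{\rho}(G)$ be the maximum, over all vertices $v$ of $G$, of the chromatic number of the subgraph of $G$ induced on the set of vertices at distance at most $\rho$ from $v$ (and $\chi^{\rho}(G)=0$ if $G$ has no vertices). A hole in $G$ is an induced cycle of length at least four. A hole $H$ in $G$ is $d$-peripheral if $\chi(G[X])>d$, where $X$ is the set of vertices of $G$ that are not in $V(H)$ and have no neighbour in $V(H)$. For all integers $\ell\ge 2$ and $\tau,d\ge 0$ there is an integer $c\ge 0$ with the following property. Let $G$ be a graph such that $\chi^8(G)\le \tau$, and such that every induced subgraph $J$ of $G$ with $\omega(J)<\omega(G)$ has chromatic number at most $\tau$. If $\chi(G)>c$, then there are $\ell$ $d$-peripheral holes in $G$ with lengths of all possible values modulo $\ell$; that is, for every $r\in\{0,\ldots,\ell-1\}$ there is a $d$-peripheral hole in $G$ whose length is congruent to $r$ modulo $\ell$. -/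

import Mathlib

universe u

namespace PeripheralHoles

variable {V : Type u}

/-- The closed ball `N^ρ[v]`: all vertices at distance at most `ρ` from `v`, where the distance is
infinite between different components. -/
def closedBall (G : SimpleGraph V) (ρ : ℕ) (v : V) : Set V :=
  {u | G.edist v u ≤ ρ}

/-- The local chromatic number `χ^ρ(G)`: the largest chromatic number of a subgraph induced on a
ball `N^ρ[v]`. The supremum in `ℕ∞` is `0` for the null graph. -/
noncomputable def localChromaticNumber (G : SimpleGraph V) (ρ : ℕ) : ℕ∞ :=
  ⨆ v : V, (G.induce (closedBall G ρ v)).chromaticNumber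

/-- A hole is an induced cycle of length at least four. -/
structure IsHole {G : SimpleGraph V} {v : V} (H : G.Walk v v) : Prop where
  isCycle : H.IsCycle
  isInduced : H.toSubgraph.IsInduced
  four_le_length : 4 ≤ H.length

/-- The vertices outside `H` that have no neighbour in `H`. -/
def farFrom {G : SimpleGraph V} {v : V} (H : G.Walk v v) : Set V :=
  {x | x ∉ H.support ∧ ∀ y ∈ H.support, ¬ G.Adj x y}

/-- `H` is `d`-peripheral if the vertices outside `H` with no neighbour in `H` induce a subgraph
of chromatic number more than `d`. -/
def IsPeripheral {G : SimpleGraph V} {v : V} (d : ℕ) (H : G.Walk v v) : Prop :=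
  (d : ℕ∞) < (G.induce (farFrom H)).chromaticNumber

end PeripheralHoles

/-! The object to grow is a `Chain`: induced paths from `z` to `z₀` whose lengths realise `t + 1`
consecutive residues modulo `ℓ`, a connected set `X` of large chromatic number attached to them only
at `z`, and a set `B` covering `X` outside a small ball about `z`. Each `b ∈ B` has a fixed return
path to `b₀`, a neighbour of `z₀`. Going from `z` through `X` to some `b` and back via `b₀` closes
every path of the chain at the same extra cost, so `ℓ` consecutive residues give holes of all
residues. The excursion through `X` stays within distance 7 of `z`, hence `X` minus the 8-ball is
far from the hole, and deleting that ball costs only `τ` colours.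

A chain gains a residue from a square edge: an edge `uv` with parents `p` of `u` and `q` of `v`,
where `p` is nonadjacent to `v`. The routes `v, q, …, z` and `v, u, p, …, z` are arranged to differ
in length by one modulo `ℓ`. Square edges abound: in a set without them, the latest parent of a
clique is complete to the clique, so the clique number drops and the set is `τ`-colourable. A
connectivity argument in the graph of square edges finds one with `v`, but not `u`, attached to a
large set whose parents all come later (`exists_square_edge`).

The routes must also avoid the vertices of `B` kept for later. Take breadth-first levels of `X` from
`z`, and let the height of `b` be the lowest level where it has a neighbour. In a level `k` of large
chromatic number, either many vertices have a cover of height at least `k - 2`, and the parents are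
taken in level `k - 1` (`Chain.step_of_high`); or many have only lower covers, and the parents are
taken in `B`, ordered by height and sorted by height modulo `ℓ` (`Chain.step_of_low`). Either way a
kept cover could meet the new routes only close to `v`, so it suffices to discard a ball about `v`.
-/

namespace PeripheralHoles

/-! ### Colourings of vertex sets -/

variable {V : Type u}

/-- `S` can be properly coloured in `G` with the colours `0, …, n - 1`. -/
def ColorableOn (G : SimpleGraph V) (S : Set V) (n : ℕ) : Prop :=
  ∃ f : V → ℕ, (∀ x ∈ S, f x < n) ∧ ∀ x ∈ S, ∀ y ∈ S, G.Adj x y → f x ≠ f y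

theorem colorableOn_iff {G : SimpleGraph V} {S : Set V} {n : ℕ} :
    ColorableOn G S n ↔ (G.induce S).Colorable n := by
  classical
  constructor
  · rintro ⟨f, hf, hG⟩
    exact ⟨SimpleGraph.Coloring.mk (fun x => (⟨f x, hf x x.2⟩ : Fin n)) (by
      intro x y hxy h
      exact hG x x.2 y y.2 hxy (congrArg Fin.val h))⟩
  · rintro ⟨c⟩
    refine ⟨fun x => if h : x ∈ S then c ⟨x, h⟩ else 0, fun x hx => by simp [hx], ?_⟩
    intro x hx y hy hxy h
    simp only [hx, hy, dif_pos] at h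
    exact c.valid (v := ⟨x, hx⟩) (w := ⟨y, hy⟩) hxy (Fin.ext h)

theorem not_colorableOn_iff {G : SimpleGraph V} {S : Set V} {n : ℕ} :
    ¬ ColorableOn G S n ↔ (n : ℕ∞) < (G.induce S).chromaticNumber := by
  rw [colorableOn_iff, ← SimpleGraph.chromaticNumber_le_iff_colorable, not_le]

namespace ColorableOn

variable {G H : SimpleGraph V} {S T : Set V} {m n : ℕ}

theorem mono (h : ColorableOn G T m) (hS : S ⊆ T) (hmn : m ≤ n) : ColorableOn G S n := by
  obtain ⟨f, hf, hG⟩ := h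
  exact ⟨f, fun x hx => (hf x (hS hx)).trans_le hmn,
    fun x hx y hy => hG x (hS hx) y (hS hy)⟩

theorem mono_left (h : ColorableOn H S m) (hGH : G ≤ H) : ColorableOn G S m := by
  obtain ⟨f, hf, hG⟩ := h
  exact ⟨f, hf, fun x hx y hy hxy => hG x hx y hy (hGH hxy)⟩

/-- Product colouring: the pair (fibre, colour in the fibre) is written in base `m`, so division by
`m` recovers the fibre. -/
theorem of_fibers (p : V → ℕ) (hp : ∀ x ∈ S, p x < n)
    (h : ∀ i < n, ColorableOn G {x ∈ S | p x = i} m) : ColorableOn G S (n * m) := by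
  classical
  choose! f hf hG using h
  refine ⟨fun x => f (p x) x + m * p x, fun x hx => ?_, fun x hx y hy hxy heq => ?_⟩
  · have h1 := hf (p x) (hp x hx) x ⟨hx, rfl⟩
    have h2 := hp x hx
    calc f (p x) x + m * p x < m + m * p x := by omega
      _ = m * (p x + 1) := by ring
      _ ≤ m * n := Nat.mul_le_mul_left _ h2
      _ = n * m := mul_comm _ _
  · have h1 := hf (p x) (hp x hx) x ⟨hx, rfl⟩
    have h2 := hf (p y) (hp y hy) y ⟨hy, rfl⟩
    have hm : 0 < m := by omega
    have e1 := congrArg (· / m) heq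
    simp only [Nat.add_mul_div_left _ _ hm, Nat.div_eq_of_lt h1, Nat.div_eq_of_lt h2,
      zero_add] at e1
    simp only [e1] at heq h1
    exact hG (p y) (hp y hy) x ⟨hx, e1⟩ y ⟨hy, rfl⟩ hxy (by omega)

theorem union (hS : ColorableOn G S m) (hT : ColorableOn G T n) :
    ColorableOn G (S ∪ T) (m + n) := by
  classical
  obtain ⟨f, hf, hG⟩ := hS
  obtain ⟨g, hg, hG'⟩ := hT
  have hT' : ∀ x ∈ S ∪ T, x ∉ S → x ∈ T := fun x hx h => hx.resolve_left h
  refine ⟨fun x => if x ∈ S then f x else m + g x, fun x hx => ?_, fun x hx y hy hxy => ?_⟩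
  · by_cases h : x ∈ S
    · have := hf x h
      simp only [h, if_true]; omega
    · have := hg x (hT' x hx h)
      simp only [h, if_false]; omega
  · by_cases h : x ∈ S <;> by_cases h' : y ∈ S <;> simp only [h, h', if_true, if_false]
    · exact hG x h y h' hxy
    · have := hf x h; omega
    · have := hf y h'; omega
    · have := hG' x (hT' x hx h) y (hT' y hy h') hxy; omega

theorem of_diff (hT : ColorableOn G T n) (hS : ColorableOn G (S \ T) m) :
    ColorableOn G S (m + n) :=
  (hS.union hT).mono (fun x hx => by by_cases h : x ∈ T <;> simp [h, hx]) le_rfl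

theorem union_of_anticomplete (hS : ColorableOn G S n) (hT : ColorableOn G T n)
    (hST : ∀ x ∈ S, ∀ y ∈ T, ¬ G.Adj x y) : ColorableOn G (S ∪ T) n := by
  classical
  obtain ⟨f, hf, hG⟩ := hS
  obtain ⟨g, hg, hG'⟩ := hT
  have hT' : ∀ x ∈ S ∪ T, x ∉ S → x ∈ T := fun x hx h => hx.resolve_left h
  refine ⟨fun x => if x ∈ S then f x else g x, fun x hx => ?_, fun x hx y hy hxy => ?_⟩
  · by_cases h : x ∈ S
    · simp only [h, if_true]; exact hf x h
    · simp only [h, if_false]; exact hg x (hT' x hx h)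
  · by_cases h : x ∈ S <;> by_cases h' : y ∈ S <;> simp only [h, h', if_true, if_false]
    · exact hG x h y h' hxy
    · exact absurd hxy (hST x h y (hT' y hy h'))
    · exact absurd hxy.symm (hST y h' x (hT' x hx h))
    · exact hG' x (hT' x hx h) y (hT' y hy h') hxy

theorem empty : ColorableOn G ∅ n := ⟨fun _ => 0, by simp, by simp⟩

end ColorableOn

theorem nonempty_of_not_colorableOn {G : SimpleGraph V} {S : Set V} {n : ℕ}
    (h : ¬ ColorableOn G S n) : S.Nonempty := by
  rw [Set.nonempty_iff_ne_empty]
  rintro rfl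
  exact h .empty

/-! ### Connected sets and components -/

/-- `S` is nonempty and induces a connected subgraph of `G`. -/
def ConnectedOn (G : SimpleGraph V) (S : Set V) : Prop :=
  S.Nonempty ∧ ∀ A ⊆ S, A.Nonempty → (∀ x ∈ A, ∀ y ∈ S, G.Adj x y → y ∈ A) → S ⊆ A

namespace ConnectedOn

variable {G H : SimpleGraph V} {S T : Set V}

theorem exists_adj (h : ConnectedOn G S) {A : Set V} (hA : A ⊆ S) (hne : A.Nonempty)
    (hSA : ¬ S ⊆ A) : ∃ x ∈ A, ∃ y ∈ S, y ∉ A ∧ G.Adj x y := by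
  by_contra! hcon
  exact hSA (h.2 A hA hne fun x hx y hy hxy => by_contra fun hyA => hcon x hx y hy hyA hxy)

theorem mono_left (h : ConnectedOn G S) (hGH : G ≤ H) : ConnectedOn H S :=
  ⟨h.1, fun A hA hne hcl => h.2 A hA hne fun x hx y hy hxy => hcl x hx y hy (hGH hxy)⟩

theorem singleton (v : V) : ConnectedOn G {v} :=
  ⟨⟨v, rfl⟩, fun A hA hne _ => by
    obtain ⟨x, hx⟩ := hne
    have := hA hx
    simp only [Set.mem_singleton_iff] at this
    subst this
    simpa using hx⟩

theorem insert (h : ConnectedOn G S) {v x : V} (hx : x ∈ S) (hvx : G.Adj v x) :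
    ConnectedOn G (insert v S) := by
  refine ⟨⟨v, Set.mem_insert _ _⟩, fun A hA hne hcl => ?_⟩
  have hxA : x ∈ A := by
    obtain ⟨y, hy⟩ := hne
    rcases hA hy with rfl | hyS
    · exact hcl y hy x (Or.inr hx) hvx
    · exact (h.2 (A ∩ S) Set.inter_subset_right ⟨y, hy, hyS⟩
        (fun a ha b hb hab => ⟨hcl a ha.1 b (Or.inr hb) hab, hb⟩) hx).1
  have hS : S ⊆ A := fun y hy => (h.2 (A ∩ S) Set.inter_subset_right ⟨x, hxA, hx⟩
        (fun a ha b hb hab => ⟨hcl a ha.1 b (Or.inr hb) hab, hb⟩) hy).1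
  exact Set.insert_subset (hcl x hxA v (Or.inl rfl) hvx.symm) hS

theorem union (hS : ConnectedOn G S) (hT : ConnectedOn G T) {x : V} (hxS : x ∈ S) (hxT : x ∈ T) :
    ConnectedOn G (S ∪ T) := by
  refine ⟨⟨x, Or.inl hxS⟩, fun A hA hne hcl => ?_⟩
  have key : ∀ R : Set V, R ⊆ S ∪ T → ConnectedOn G R → (A ∩ R).Nonempty → R ⊆ A :=
    fun R hR hc hn y hy => (hc.2 (A ∩ R) Set.inter_subset_right hn
      (fun a ha b hb hab => ⟨hcl a ha.1 b (hR hb) hab, hb⟩) hy).1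
  have hxA : x ∈ A := by
    obtain ⟨y, hy⟩ := hne
    rcases hA hy with h | h
    · exact key S Set.subset_union_left hS ⟨y, hy, h⟩ hxS
    · exact key T Set.subset_union_right hT ⟨y, hy, h⟩ hxT
  exact Set.union_subset (key S Set.subset_union_left hS ⟨x, hxA, hxS⟩)
    (key T Set.subset_union_right hT ⟨x, hxA, hxT⟩)

end ConnectedOn

/-- A set that is not `n`-colourable has a component that is not `n`-colourable. -/
theorem exists_component [Finite V] {G : SimpleGraph V} {S : Set V} {n : ℕ}
    (h : ¬ ColorableOn G S n) :
    ∃ X ⊆ S, ConnectedOn G X ∧ ¬ ColorableOn G X n ∧ ∀ x ∈ X, ∀ y ∈ S, G.Adj x y → y ∈ X := by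
  -- A minimal such union of components is connected: otherwise it splits into two anticomplete
  -- parts, one of which is again not `n`-colourable.
  let F : Set (Set V) := {X | X ⊆ S ∧ ¬ ColorableOn G X n ∧ ∀ x ∈ X, ∀ y ∈ S, G.Adj x y → y ∈ X}
  have hF : F.Nonempty := ⟨S, subset_rfl, h, fun _ _ y hy _ => hy⟩
  obtain ⟨X, hX⟩ := (Set.toFinite F).exists_minimal hF
  obtain ⟨hXS, hXn, hXc⟩ := hX.1
  refine ⟨X, hXS, ⟨nonempty_of_not_colorableOn hXn, fun A hA hne hcl => ?_⟩, hXn, hXc⟩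
  by_cases hAn : ColorableOn G A n
  · by_cases hBn : ColorableOn G (X \ A) n
    · refine absurd ((hAn.union_of_anticomplete hBn ?_).mono ?_ le_rfl) hXn
      · exact fun x hx y hy hxy => hy.2 (hcl x hx y hy.1 hxy)
      · intro x hx
        by_cases hxA : x ∈ A <;> simp [hx, hxA]
    · have := hX.2 (y := X \ A) ⟨Set.sdiff_subset.trans hXS, hBn, fun x hx y hy hxy => ?_⟩
        Set.sdiff_subset
      · obtain ⟨a, ha⟩ := hne
        exact absurd ha (this (hA ha)).2
      · exact ⟨hXc x hx.1 y hy hxy, fun hyA => hx.2 (hcl y hyA x hx.1 hxy.symm)⟩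
  · exact hX.2 (y := A) ⟨hA.trans hXS, hAn, fun x hx y hy hxy =>
      hcl x hx y (hXc x (hA hx) y hy hxy) hxy⟩ hA

/-! ### Balls and breadth-first levels -/

theorem mem_closedBall_self {G : SimpleGraph V} (n : ℕ) (v : V) : v ∈ closedBall G n v := by
  simp [closedBall]

theorem closedBall_mono {G : SimpleGraph V} {m n : ℕ} (h : m ≤ n) (v : V) :
    closedBall G m v ⊆ closedBall G n v := fun _ hx =>
  le_trans (show _ ≤ (m : ℕ∞) from hx) (by exact_mod_cast h)

theorem mem_closedBall_of_adj {G : SimpleGraph V} {n : ℕ} {v x y : V}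
    (hx : x ∈ closedBall G n v) (hxy : G.Adj x y) : y ∈ closedBall G (n + 1) v := by
  simp only [closedBall, Set.mem_ofPred_eq] at *
  calc G.edist v y ≤ G.edist v x + G.edist x y := SimpleGraph.edist_triangle
    _ ≤ n + 1 := add_le_add hx (SimpleGraph.edist_eq_one_iff_adj.2 hxy).le
    _ = _ := by push_cast; rfl

theorem colorableOn_closedBall {G : SimpleGraph V} {τ : ℕ} (h : localChromaticNumber G 8 ≤ τ)
    {n : ℕ} (hn : n ≤ 8) (v : V) : ColorableOn G (closedBall G n v) τ :=
  (colorableOn_iff.2 (SimpleGraph.chromaticNumber_le_iff_colorable.1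
    ((le_iSup (fun v => (G.induce (closedBall G 8 v)).chromaticNumber) v).trans h))).mono
    (closedBall_mono hn v) le_rfl

/-- Breadth-first levels of a connected set. -/
structure IsLevel (G : SimpleGraph V) (S : Set V) (z : V) (lev : V → ℕ) : Prop where
  mem : z ∈ S
  root : ∀ x ∈ S, lev x = 0 ↔ x = z
  pred : ∀ x ∈ S, ∀ n, lev x = n + 1 → ∃ y ∈ S, lev y = n ∧ G.Adj x y
  step : ∀ x ∈ S, ∀ y ∈ S, G.Adj x y → lev y ≤ lev x + 1

theorem ConnectedOn.exists_isLevel {G : SimpleGraph V} {S : Set V} (h : ConnectedOn G S) {z : V}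
    (hz : z ∈ S) : ∃ lev, IsLevel G S z lev := by
  classical
  -- `R n` collects the ends of walks of length exactly `n` from `z` inside `S`; the level is the
  -- least such `n`.
  let R : ℕ → Set V := fun n => Nat.rec {z} (fun _ A => {x | x ∈ S ∧ ∃ y ∈ A, G.Adj y x}) n
  have R0 : ∀ x, x ∈ R 0 ↔ x = z := fun x => Iff.rfl
  have RS : ∀ n x, x ∈ R (n + 1) ↔ x ∈ S ∧ ∃ y ∈ R n, G.Adj y x := fun n x => Iff.rfl
  have hRS : ∀ n, R n ⊆ S := by
    rintro (_ | n) x hx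
    · rw [R0] at hx; exact hx ▸ hz
    · exact ((RS n x).1 hx).1
  have hex : ∀ x ∈ S, ∃ n, x ∈ R n := by
    have := h.2 {x | x ∈ S ∧ ∃ n, x ∈ R n} (fun x hx => hx.1) ⟨z, hz, 0, (R0 z).2 rfl⟩
      (fun x hx y hy hxy => ⟨hy, hx.2.choose + 1, (RS _ _).2 ⟨hy, x, hx.2.choose_spec, hxy⟩⟩)
    exact fun x hx => (this hx).2
  let lev : V → ℕ := fun x => sInf {n | x ∈ R n}
  have hlev : ∀ x ∈ S, x ∈ R (lev x) := fun x hx => Nat.sInf_mem (s := {n | x ∈ R n}) (hex x hx)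
  have hmin : ∀ x n, x ∈ R n → lev x ≤ n := fun x n hx => Nat.sInf_le (s := {n | x ∈ R n}) hx
  have hstep : ∀ x ∈ S, ∀ y ∈ S, G.Adj x y → lev y ≤ lev x + 1 := fun x hx y hy hxy =>
    hmin y _ ((RS _ _).2 ⟨hy, x, hlev x hx, hxy⟩)
  refine ⟨lev, hz, fun x hx => ⟨fun h0 => ?_, ?_⟩, fun x hx n hn => ?_, hstep⟩
  · have := hlev x hx
    rw [h0] at this
    exact this
  · rintro rfl
    exact Nat.le_zero.1 (hmin _ 0 rfl)
  · have h1 := hlev x hx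
    rw [hn, RS] at h1
    obtain ⟨_, y, hy, hyx⟩ := h1
    have h2 := hmin y n hy
    have h3 := hstep y (hRS n hy) x hx hyx
    exact ⟨y, hRS n hy, by omega, hyx.symm⟩

theorem IsLevel.mem_closedBall {G : SimpleGraph V} {S : Set V} {z : V} {lev : V → ℕ}
    (h : IsLevel G S z lev) : ∀ n, ∀ x ∈ S, lev x = n → x ∈ closedBall G n z := by
  intro n
  induction n with
  | zero => exact fun x hx h0 => (h.root x hx).1 h0 ▸ mem_closedBall_self _ _
  | succ n ih =>
    intro x hx hn
    obtain ⟨y, hy, hyn, hxy⟩ := h.pred x hx n hn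
    exact mem_closedBall_of_adj (ih y hy hyn) hxy.symm

/-- If every level is `m`-colourable then the whole set is `2m`-colourable. -/
theorem IsLevel.exists_not_colorableOn {G : SimpleGraph V} {S T : Set V} {z : V} {lev : V → ℕ}
    (h : IsLevel G S z lev) (hT : T ⊆ S) {m : ℕ} (hm : ¬ ColorableOn G T (2 * m)) :
    ∃ k, ¬ ColorableOn G {x ∈ T | lev x = k} m := by
  by_contra! hcon
  choose f hf hG using hcon
  -- Edges change the level by at most one, so adjacent vertices with levels of equal parity share a
  -- level.
  refine hm (.of_fibers (fun x => lev x % 2) (fun x _ => Nat.mod_lt _ two_pos) fun i _ =>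
    ⟨fun x => f (lev x) x, fun x hx => hf _ x ⟨hx.1, rfl⟩, fun x hx y hy hxy => ?_⟩)
  have h1 := h.step x (hT hx.1) y (hT hy.1) hxy
  have h2 := h.step y (hT hy.1) x (hT hx.1) hxy.symm
  have h3 : lev x % 2 = lev y % 2 := hx.2.trans hy.2.symm
  have h4 : lev x = lev y := by omega
  simp only [h4]
  exact hG _ x ⟨hx.1, h4⟩ y ⟨hy.1, rfl⟩ hxy

/-! ### Square edges -/

/-- In a graph of large chromatic number graded by `t`, there are two connected sets `X`, `Y` of
large chromatic number joined by an edge, with `Y` earlier than `X`. -/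
theorem exists_connectedOn_pair_of_grading [Finite V] {H : SimpleGraph V} {F : Set V} {t : V → ℕ}
    {w c : ℕ} (hw : ∀ i, ColorableOn H {x ∈ F | t x = i} w) (hF : ¬ ColorableOn H F (2 * c + w)) :
    ∃ X ⊆ F, ∃ Y ⊆ F, ConnectedOn H X ∧ ConnectedOn H Y ∧ ¬ ColorableOn H X c ∧
      ¬ ColorableOn H Y c ∧ (∀ y ∈ Y, ∀ x ∈ X, t y < t x) ∧ ∃ y ∈ Y, ∃ x ∈ X, H.Adj y x := by
  -- `S` consists of the possible latest vertices of large connected sets. A large component of `F \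
  -- S` would have its own latest vertex in `S`.
  let S : Set V := {v ∈ F | ∃ Y ⊆ F, ConnectedOn H Y ∧ v ∈ Y ∧ (∀ y ∈ Y, t y ≤ t v) ∧
    ¬ ColorableOn H Y c}
  have hFS : ColorableOn H (F \ S) c := by
    by_contra hcon
    obtain ⟨Y, hYF, hY, hYc, -⟩ := exists_component hcon
    obtain ⟨v, hv, hmax⟩ := Set.exists_max_image Y t (Set.toFinite Y) hY.1
    exact (hYF hv).2 ⟨(hYF hv).1, Y, fun y hy => (hYF hy).1, hY, hv, hmax, hYc⟩
  have hS : ¬ ColorableOn H S (c + w) := fun h =>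
    hF ((h.of_diff hFS).mono subset_rfl (by omega))
  obtain ⟨D, hDS, hD, hDc, -⟩ := exists_component hS
  obtain ⟨u₀, hu₀, hmin⟩ := Set.exists_min_image D t (Set.toFinite D) hD.1
  have hDF : D ⊆ F := fun x hx => (hDS hx).1
  -- Deleting the earliest grade of `D` leaves a large component `X`. It has a neighbour `u` in that
  -- grade, and the set `Y` that witnesses `u ∈ S` precedes `X`.
  let W : Set V := {x ∈ D | t x = t u₀}
  have hDW : ¬ ColorableOn H (D \ W) c := fun h =>
    hDc (ColorableOn.of_diff ((hw (t u₀)).mono (fun x hx => ⟨hDF hx.1, hx.2⟩) le_rfl) h)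
  obtain ⟨X, hXD, hX, hXc, hXcl⟩ := exists_component hDW
  obtain ⟨x, hx, u, hu, huX, hxu⟩ := hD.exists_adj (fun x hx => (hXD hx).1) hX.1
    (fun h => (hXD (h hu₀)).2 ⟨hu₀, rfl⟩)
  have huW : t u = t u₀ := by
    by_contra hne
    exact huX (hXcl x hx u ⟨hu, fun h => hne h.2⟩ hxu)
  obtain ⟨-, Y, hYF, hY, huY, hYt, hYc⟩ := hDS hu
  refine ⟨X, fun x hx => hDF (hXD hx).1, Y, hYF, hX, hY, hXc, hYc, fun y hy x hx => ?_,
    u, huY, x, hx, hxu.symm⟩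
  have h1 := hmin x (hXD hx).1
  have h2 : t x ≠ t u₀ := fun h => (hXD hx).2 ⟨(hXD hx).1, h⟩
  have h3 := hYt y hy
  omega

/-- If `Y` is connected in a subgraph `H`, has large chromatic number, and is attached to the
connected set `X`, then some edge of `H[Y]` is attached to a large connected subset of `X` at
exactly one of its ends. -/
theorem exists_edge_attached_at_one_end [Finite V] {G H : SimpleGraph V} {X Y : Set V} {τ c : ℕ}
    (hN : ∀ v, ColorableOn G (G.neighborSet v) τ) (hY : ConnectedOn H Y)
    (hYτ : ¬ ColorableOn G Y τ) (hX : ConnectedOn G X) (hXc : ¬ ColorableOn G X (c + τ))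
    (hXY : ∃ y ∈ Y, ∃ x ∈ X, G.Adj y x) :
    ∃ X' ⊆ X, ∃ u ∈ Y, ∃ v ∈ Y, ConnectedOn G X' ∧ ¬ ColorableOn G X' c ∧ H.Adj u v ∧
      (∃ x ∈ X', G.Adj v x) ∧ ∀ x ∈ X', ¬ G.Adj u x := by
  -- Take a maximal large connected `Z` missed by some `y ∈ Y`. If another vertex of `Y` touches
  -- `Z`, connectivity of `H[Y]` gives the edge.
  let F : Set (Set V) := {Z | Z ⊆ X ∧ ConnectedOn G Z ∧ ¬ ColorableOn G Z c ∧
    ∃ y ∈ Y, ∀ x ∈ Z, ¬ G.Adj y x}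
  have hF : F.Nonempty := by
    obtain ⟨y, hy⟩ := hY.1
    have : ¬ ColorableOn G (X \ G.neighborSet y) c := fun h => hXc (ColorableOn.of_diff (hN y) h)
    obtain ⟨Z, hZ, hZ1, hZ2, -⟩ := exists_component this
    exact ⟨Z, fun z hz => (hZ hz).1, hZ1, hZ2, y, hy, fun x hx => (hZ hx).2⟩
  obtain ⟨Z, hZ⟩ := (Set.toFinite F).exists_maximal hF
  obtain ⟨hZX, hZconn, hZc, y, hy, hyZ⟩ := hZ.1
  by_cases htouch : ∃ y' ∈ Y, ∃ x ∈ Z, G.Adj y' x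
  · obtain ⟨y', hy', hy'Z⟩ := htouch
    obtain ⟨v, hv, u, hu, huA, hvu⟩ := hY.exists_adj (A := {v ∈ Y | ∃ x ∈ Z, G.Adj v x})
      (fun x hx => hx.1) ⟨y', hy', hy'Z⟩ (fun h => by
        obtain ⟨-, x, hx, hyx⟩ := h hy
        exact hyZ x hx hyx)
    exact ⟨Z, hZX, u, hu, v, hv.1, hZconn, hZc, hvu.symm, hv.2,
      fun x hx hux => huA ⟨hu, x, hx, hux⟩⟩
  · push Not at htouch
    obtain ⟨z, hz, x, hx, hxZ, hzx⟩ := hX.exists_adj hZX hZconn.1 (fun h => by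
      obtain ⟨y, hy, x, hx, hyx⟩ := hXY
      exact htouch y hy x (h hx) hyx)
    -- If `Y` misses `Z` altogether, maximality against `insert x Z` makes every vertex of `Y`
    -- adjacent to `x`, so `Y` lies in one neighbourhood.
    refine absurd ((hN x).mono (fun y hy => ?_) le_rfl) hYτ
    by_contra hxy
    have := hZ.2 (y := insert x Z) ⟨Set.insert_subset hx hZX, hZconn.insert hz hzx.symm,
      fun h => hZc (h.mono (Set.subset_insert _ _) le_rfl), y, hy, ?_⟩ (Set.subset_insert _ _)
    · exact hxZ (this (Set.mem_insert _ _))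
    · rintro x' (rfl | hx') hadj
      · exact hxy hadj.symm
      · exact htouch y hy x' hx' hadj

/-- The graph of square edges: edges `uv` such that the chosen parents `e u`, `e v` are
nonadjacent to `v`, `u` respectively. -/
def squareGraph (G : SimpleGraph V) (e : V → V) : SimpleGraph V where
  Adj u v := G.Adj u v ∧ ¬ G.Adj (e u) v ∧ ¬ G.Adj (e v) u
  symm := ⟨fun _ _ h => ⟨h.1.symm, h.2.2, h.2.1⟩⟩
  loopless := ⟨fun _ h => G.loopless.irrefl _ h.1⟩

/-- A set without square edges has smaller clique number than the whole graph. -/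
theorem colorableOn_of_no_square_edges [Finite V] {G : SimpleGraph V} {τ : ℕ}
    (hω : ∀ S : Set V, (G.induce S).cliqueNum < G.cliqueNum → (G.induce S).chromaticNumber ≤ τ)
    {D : Set V} {e : V → V} {rank : V → ℕ} (hrank : rank.Injective)
    (he : ∀ x ∈ D, G.Adj (e x) x)
    (hmin : ∀ x ∈ D, ∀ y ∈ D, G.Adj (e y) x → rank (e x) ≤ rank (e y))
    (hD : ∀ x ∈ D, ∀ y ∈ D, ¬ (squareGraph G e).Adj x y) : ColorableOn G D τ := by
  classical
  rcases D.eq_empty_or_nonempty with rfl | hne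
  · exact .empty
  refine colorableOn_iff.2 (SimpleGraph.chromaticNumber_le_iff_colorable.1 (hω D ?_))
  obtain ⟨K, hK⟩ := (G.induce D).exists_isNClique_cliqueNum
  let K' : Finset V := K.map (Function.Embedding.subtype _)
  have hK'D : ∀ x ∈ K', x ∈ D := by
    intro x hx
    simp only [K', Finset.mem_map, Function.Embedding.subtype_apply] at hx
    obtain ⟨a, -, rfl⟩ := hx
    exact a.2
  have hK'cl : ∀ x ∈ K', ∀ y ∈ K', x ≠ y → G.Adj x y := by
    intro x hx y hy hxy
    simp only [K', Finset.mem_map, Function.Embedding.subtype_apply] at hx hy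
    obtain ⟨a, ha, rfl⟩ := hx
    obtain ⟨b, hb, rfl⟩ := hy
    exact hK.1 ha hb (fun h => hxy (congrArg _ h))
  have hcard : K'.card = (G.induce D).cliqueNum := by rw [Finset.card_map, hK.2]
  rw [← hcard]
  -- The latest parent in a maximum clique of `D` is complete to that clique, which therefore
  -- extends in `G`.
  have key : ∃ q, ∀ x ∈ K', G.Adj q x := by
    rcases K'.eq_empty_or_nonempty with h | h
    · obtain ⟨x, hx⟩ := hne
      exact ⟨x, by simp [h]⟩
    · obtain ⟨v, hv, hmax⟩ := K'.exists_max_image (fun x => rank (e x)) h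
      refine ⟨e v, fun x hx => ?_⟩
      by_cases hxv : x = v
      · exact hxv ▸ he v (hK'D v hv)
      have h1 := hD x (hK'D x hx) v (hK'D v hv)
      by_contra h2
      have h3 : G.Adj (e x) v := by
        by_contra h3
        exact h1 ⟨hK'cl x hx v hv hxv, h3, h2⟩
      have h4 := hmin v (hK'D v hv) x (hK'D x hx) h3
      have h5 : e x = e v := hrank (le_antisymm (hmax x hx) h4)
      exact h2 (h5 ▸ he x (hK'D x hx))
  obtain ⟨q, hq⟩ := key
  have hqK : q ∉ K' := fun h => G.loopless.irrefl _ (hq q h)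
  have hcl : G.IsClique (insert q K' : Finset V) := by
    intro x hx y hy hxy
    simp only [Finset.coe_insert, Set.mem_insert_iff, Finset.mem_coe] at hx hy
    rcases hx with rfl | hx <;> rcases hy with rfl | hy
    · exact absurd rfl hxy
    · exact hq y hy
    · exact (hq x hx).symm
    · exact hK'cl x hx y hy hxy
  have := SimpleGraph.IsClique.card_le_cliqueNum (tc := hcl)
  rw [Finset.card_insert_of_notMem hqK] at this
  omega

/-- Let `Q` cover `F`, ordered by `rank`. If `F` has large chromatic number then there is an edge
`uv` with parents `p`, `q` respectively, `p` nonadjacent to `v`, and a large connected set `X`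
attached to `v` and not to `u`, `p`, `q`, all of whose parents come after `p` and `q`. -/
theorem exists_square_edge [Finite V] {G : SimpleGraph V} {τ c : ℕ}
    (hω : ∀ S : Set V, (G.induce S).cliqueNum < G.cliqueNum → (G.induce S).chromaticNumber ≤ τ)
    (hN : ∀ v, ColorableOn G (G.neighborSet v) τ)
    {F Q : Set V} {rank : V → ℕ} (hrank : rank.Injective)
    (hQ : ∀ x ∈ F, ∃ q ∈ Q, G.Adj q x)
    (hF : ¬ ColorableOn G F ((2 * (c + τ) + 1) * τ)) :
    ∃ X ⊆ F, ∃ u ∈ F, ∃ v ∈ F, ∃ p ∈ Q, ∃ q ∈ Q, ConnectedOn G X ∧ ¬ ColorableOn G X c ∧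
      v ∉ X ∧ u ∉ X ∧
      G.Adj u v ∧ G.Adj p u ∧ ¬ G.Adj p v ∧ G.Adj q v ∧ (∃ x ∈ X, G.Adj v x) ∧
      (∀ x ∈ X, ¬ G.Adj u x) ∧ (∀ x ∈ X, ∀ b ∈ Q, G.Adj b x → rank p < rank b ∧ rank q < rank b) ∧
      (∀ b ∈ Q, G.Adj b u → rank p ≤ rank b) ∧ (∀ b ∈ Q, G.Adj b v → rank q ≤ rank b) := by
  have hex : ∀ x, ∃ e, x ∈ F → e ∈ Q ∧ G.Adj e x ∧ ∀ b ∈ Q, G.Adj b x → rank e ≤ rank b := by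
    intro x
    by_cases hx : x ∈ F
    · obtain ⟨q, hq, hmin⟩ := Set.exists_min_image {q ∈ Q | G.Adj q x} rank (Set.toFinite _)
        (hQ x hx)
      exact ⟨q, fun _ => ⟨hq.1, hq.2, fun b hb hbx => hmin b ⟨hb, hbx⟩⟩⟩
    · exact ⟨x, fun h => absurd h hx⟩
  choose e he using hex
  let H := squareGraph G e
  have hHG : H ≤ G := fun _ _ h => h.1
  -- A colour class of the square graph spans no square edge, hence costs at most `τ` colours in
  -- `G`.
  have hHF : ¬ ColorableOn H F (2 * (c + τ) + 1) := by
    rintro ⟨f, hf, hfH⟩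
    refine hF (.of_fibers f hf fun i _ => colorableOn_of_no_square_edges hω hrank
      (e := e) (fun x hx => (he x hx.1).2.1)
      (fun x hx y hy hxy => (he x hx.1).2.2 _ (he y hy.1).1 hxy) fun x hx y hy hxy => ?_)
    exact hfH x hx.1 y hy.1 hxy (hx.2.trans hy.2.symm)
  obtain ⟨X, hXF, Y, hYF, hX, hY, hXc, hYc, ht, y₀, hy₀, x₀, hx₀, hxy₀⟩ :=
    -- `w = 1` because two vertices with the same parent are never joined by a square edge.
    exists_connectedOn_pair_of_grading (t := fun x => rank (e x)) (w := 1) (fun i =>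
      ⟨fun _ => 0, by simp, fun x hx y hy hxy => by
        have : e x = e y := hrank (hx.2.trans hy.2.symm)
        exact absurd (this ▸ (he y hy.1).2.1) hxy.2.1⟩) hHF
  obtain ⟨X', hX'X, u, hu, v, hv, hX', hX'c, huv, hvX', huX'⟩ :=
    exists_edge_attached_at_one_end (c := c) (τ := τ) hN hY
      (fun h => hYc ((h.mono_left hHG).mono subset_rfl (by omega)))
      (hX.mono_left hHG) (fun h => hXc (h.mono_left hHG)) ⟨y₀, hy₀, x₀, hx₀, hHG hxy₀⟩
  refine ⟨X', hX'X.trans hXF, u, hYF hu, v, hYF hv, e u, (he u (hYF hu)).1, e v,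
    (he v (hYF hv)).1, hX', hX'c, fun h => (ht v hv v (hX'X h)).ne rfl,
    fun h => (ht u hu u (hX'X h)).ne rfl, huv.1, (he u (hYF hu)).2.1, huv.2.1,
    (he v (hYF hv)).2.1, hvX', huX', fun x hx b hb hbx => ?_, (he u (hYF hu)).2.2,
    (he v (hYF hv)).2.2⟩
  have h := (he x (hXF (hX'X hx))).2.2 b hb hbx
  exact ⟨(ht u hu x (hX'X hx)).trans_le h, (ht v hv x (hX'X hx)).trans_le h⟩

/-! ### Induced paths and holes -/

/-- The list `l` is the vertex sequence of an induced path of `G`. -/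
def IsInducedPath (G : SimpleGraph V) : List V → Prop
  | [] => True
  | a :: l => IsInducedPath G l ∧ a ∉ l ∧ ∀ x ∈ l, G.Adj a x ↔ l.head? = some x

namespace IsInducedPath

variable {G : SimpleGraph V}

theorem of_suffix {l l' : List V} (h : IsInducedPath G l) (hl : l' <:+ l) :
    IsInducedPath G l' := by
  induction l with
  | nil => rw [List.suffix_nil.1 hl]; exact trivial
  | cons a l ih =>
    rcases List.suffix_cons_iff.1 hl with rfl | h'
    · exact h
    · exact ih h.1 h'

theorem append {g l : List V} {z : V} (hg : IsInducedPath G (g ++ [z]))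
    (hl : IsInducedPath G (z :: l)) (hgl : ∀ x ∈ g, ∀ y ∈ l, x ≠ y ∧ ¬ G.Adj x y) :
    IsInducedPath G (g ++ z :: l) := by
  induction g with
  | nil => exact hl
  | cons a g ih =>
    obtain ⟨h1, h2, h3⟩ := hg
    refine ⟨ih h1 fun x hx => hgl x (List.mem_cons_of_mem _ hx), ?_, ?_⟩
    · intro h
      rcases List.mem_append.1 h with h | h
      · exact h2 (List.mem_append_left _ h)
      · rcases List.mem_cons.1 h with h | h
        · exact h2 (by simp [h])
        · exact (hgl a List.mem_cons_self a h).1 rfl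
    · have hhead : (g ++ z :: l).head? = (g ++ [z]).head? := by cases g <;> simp
      intro x hx
      change G.Adj a x ↔ (g ++ z :: l).head? = some x
      rw [hhead]
      rcases List.mem_append.1 hx with h | h
      · exact h3 x (List.mem_append_left _ h)
      · rcases List.mem_cons.1 h with h | h
        · exact h3 x (by simp [h])
        · refine iff_of_false (hgl a List.mem_cons_self x h).2 fun he => ?_
          have hmem := List.mem_of_mem_head? (l := g ++ [z]) (a := x) (by rw [he]; rfl)
          rcases List.mem_append.1 hmem with hm | hm
          · exact (hgl x (List.mem_cons_of_mem _ hm) x h).1 rfl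
          · have hz : x = z := by simpa using hm
            exact hl.2.1 (hz ▸ h)

/-- Start the suffix at the last neighbour of `a` on `l`. -/
theorem cons_suffix {l : List V} (hl : IsInducedPath G l) {a : V} (ha : a ∉ l)
    (hadj : ∃ x ∈ l, G.Adj a x) : ∃ l', l' ≠ [] ∧ l' <:+ l ∧ IsInducedPath G (a :: l') := by
  induction l with
  | nil => simp at hadj
  | cons y l ih =>
    by_cases h : ∃ x ∈ l, G.Adj a x
    · obtain ⟨l', h1, h2, h3⟩ := ih hl.1 (fun h => ha (List.mem_cons_of_mem _ h)) h
      exact ⟨l', h1, h2.trans (List.suffix_cons _ _), h3⟩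
    · push Not at h
      refine ⟨y :: l, by simp, List.suffix_rfl, hl, ha, fun x hx => ?_⟩
      obtain ⟨x', hx', hax'⟩ := hadj
      have hay : G.Adj a y := by
        rcases List.mem_cons.1 hx' with rfl | h'
        · exact hax'
        · exact absurd hax' (h x' h')
      rcases List.mem_cons.1 hx with rfl | h'
      · simpa using hay
      · refine iff_of_false (h x h') fun he => hl.2.1 ?_
        simp only [List.head?_cons, Option.some.injEq] at he
        rwa [he]

end IsInducedPath

theorem exists_eq_append_singleton_of_suffix {l g : List V} {z : V} (hl : l ≠ [])
    (h : l <:+ g ++ [z]) : ∃ g', g' <:+ g ∧ l = g' ++ [z] := by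
  obtain ⟨t, ht⟩ := h
  have h1 := List.dropLast_append_getLast hl
  rw [← h1, ← List.append_assoc] at ht
  obtain ⟨h2, h3⟩ := List.append_inj' ht rfl
  refine ⟨l.dropLast, ⟨t, h2⟩, ?_⟩
  rw [← h3, h1]

/-- The admissible starting vertices are closed under adjacency in `T`: a new vertex either cuts the
path or is attached at its last neighbour on it. -/
theorem ConnectedOn.exists_isInducedPath {G : SimpleGraph V} {T : Set V} (hT : ConnectedOn G T)
    {a b : V} (ha : a ∈ T) (hb : b ∈ T) :
    ∃ s, IsInducedPath G (s ++ [b]) ∧ (s ++ [b]).head? = some a ∧ ∀ x ∈ s ++ [b], x ∈ T := by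
  have key := hT.2 {a | a ∈ T ∧ ∃ s, IsInducedPath G (s ++ [b]) ∧ (s ++ [b]).head? = some a ∧
    ∀ x ∈ s ++ [b], x ∈ T} (fun x hx => hx.1)
    ⟨b, hb, [], ⟨trivial, by simp, by simp⟩, rfl, by simpa using hb⟩ ?_
  · exact (key ha).2
  · rintro x ⟨hx, s, hs, hhead, hsT⟩ y hy hxy
    refine ⟨hy, ?_⟩
    by_cases hys : y ∈ s ++ [b]
    · obtain ⟨l₁, l₂, h⟩ := List.append_of_mem hys
      have hsuf : y :: l₂ <:+ s ++ [b] := ⟨l₁, h.symm⟩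
      obtain ⟨g', hg', h'⟩ := exists_eq_append_singleton_of_suffix (by simp) hsuf
      exact ⟨g', h' ▸ hs.of_suffix hsuf, by rw [← h']; rfl,
        fun x hx => hsT x (hsuf.subset (h' ▸ hx))⟩
    · obtain ⟨l', h1, h2, h3⟩ := hs.cons_suffix hys
        ⟨x, List.mem_of_mem_head? (by rw [hhead]; rfl), hxy.symm⟩
      obtain ⟨g', hg', rfl⟩ := exists_eq_append_singleton_of_suffix h1 h2
      refine ⟨y :: g', h3, rfl, fun x hx => ?_⟩
      rcases List.mem_cons.1 hx with rfl | hx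
      · exact hy
      · exact hsT x (h2.subset hx)

/-- A geodesic from a vertex to the root of a breadth-first search. -/
theorem IsLevel.exists_geodesic {G : SimpleGraph V} {S : Set V} {z : V} {lev : V → ℕ}
    (h : IsLevel G S z lev) : ∀ n, ∀ y ∈ S, lev y = n → ∃ g, IsInducedPath G (g ++ [z]) ∧
      (g ++ [z]).head? = some y ∧ g.length = n ∧
      ∀ x ∈ g, x ∈ S ∧ 0 < lev x ∧ lev x ≤ n ∧ (lev x = n → x = y) ∧ (lev x + 1 = n → G.Adj x y) := by
  intro n
  induction n with
  | zero =>
    intro y hy hn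
    obtain rfl := (h.root y hy).1 hn
    exact ⟨[], ⟨trivial, by simp, by simp⟩, rfl, rfl, by simp⟩
  | succ n ih =>
    intro y hy hn
    obtain ⟨w, hw, hwn, hyw⟩ := h.pred y hy n hn
    obtain ⟨g, hg, hhead, hlen, hmem⟩ := ih w hw hwn
    have hz : lev z = 0 := (h.root z h.mem).2 rfl
    have hmem' : ∀ x ∈ g ++ [z], x ∈ S ∧ lev x ≤ n ∧ (lev x = n → x = w) := by
      intro x hx
      rcases List.mem_append.1 hx with hx | hx
      · exact ⟨(hmem x hx).1, (hmem x hx).2.2.1, (hmem x hx).2.2.2.1⟩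
      · obtain rfl : x = z := by simpa using hx
        refine ⟨h.mem, by omega, fun hx0 => ?_⟩
        exact ((h.root w hw).1 (by omega)).symm
    refine ⟨y :: g, ⟨hg, fun hyg => ?_, fun x hx => ?_⟩, rfl, by simp [hlen], fun x hx => ?_⟩
    · have := (hmem' y hyg).2.1
      omega
    · change G.Adj y x ↔ (g ++ [z]).head? = some x
      rw [hhead, Option.some.injEq]
      constructor
      · intro hyx
        have := h.step x (hmem' x hx).1 y hy hyx.symm
        exact ((hmem' x hx).2.2 (by have := (hmem' x hx).2.1; omega)).symm
      · rintro rfl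
        exact hyw
    · rcases List.mem_cons.1 hx with rfl | hx
      · exact ⟨hy, by omega, hn.le, fun _ => rfl, by omega⟩
      · obtain ⟨h1, h2, h3, h4, -⟩ := hmem x hx
        refine ⟨h1, h2, by omega, by omega, fun he => ?_⟩
        rw [h4 (by omega)]
        exact hyw.symm

theorem IsInducedPath.exists_walk {G : SimpleGraph V} {l : List V} (hl : IsInducedPath G l) {a b : V}
    (ha : l.head? = some a) (hb : l.getLast? = some b) : ∃ w : G.Walk a b, w.support = l ∧
      ∀ x ∈ l, ∀ y ∈ l, G.Adj x y → s(x, y) ∈ w.edges := by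
  induction l generalizing a with
  | nil => simp at ha
  | cons c l ih =>
    obtain rfl : c = a := by simpa using ha
    rcases l with _ | ⟨d, l⟩
    · obtain rfl : c = b := by simpa using hb
      refine ⟨.nil, rfl, fun x hx y hy hxy => ?_⟩
      simp only [List.mem_singleton] at hx hy
      subst hx hy
      exact absurd hxy (G.loopless.irrefl _)
    · obtain ⟨w, hw, hE⟩ := ih hl.1 (a := d) rfl (by simpa using hb)
      have hcd : G.Adj c d := (hl.2.2 d List.mem_cons_self).2 rfl
      have key : ∀ x ∈ d :: l, G.Adj c x → s(c, x) ∈ (SimpleGraph.Walk.cons hcd w).edges := by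
        intro x hx hcx
        have := (hl.2.2 x hx).1 hcx
        simp only [List.head?_cons, Option.some.injEq] at this
        subst this
        simp
      refine ⟨.cons hcd w, by simp [hw], fun x hx y hy hxy => ?_⟩
      rcases List.mem_cons.1 hx with rfl | hx' <;> rcases List.mem_cons.1 hy with rfl | hy'
      · exact absurd hxy (G.loopless.irrefl _)
      · exact key y hy' hxy
      · rw [Sym2.eq_swap]; exact key x hx' hxy.symm
      · rw [SimpleGraph.Walk.edges_cons]
        exact List.mem_cons_of_mem _ (hE x hx' y hy' hxy)

theorem IsInducedPath.nodup {G : SimpleGraph V} {l : List V} (hl : IsInducedPath G l) : l.Nodup := by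
  induction l with
  | nil => exact List.nodup_nil
  | cons a l ih => exact List.nodup_cons.2 ⟨hl.2.1, ih hl.1⟩

/-- An induced path together with a vertex adjacent exactly to its two ends is a hole. -/
theorem IsInducedPath.exists_isHole {G : SimpleGraph V} {l : List V} (hl : IsInducedPath G l) {a b v : V}
    (ha : l.head? = some a) (hb : l.getLast? = some b) (hlen : 3 ≤ l.length) (hv : v ∉ l)
    (hva : G.Adj v a) (hvb : G.Adj v b) (hvl : ∀ x ∈ l, G.Adj v x → x = a ∨ x = b) :
    ∃ H : G.Walk v v, IsHole H ∧ H.length = l.length + 1 ∧ ∀ x ∈ H.support, x = v ∨ x ∈ l := by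
  obtain ⟨w, hw, hE⟩ := hl.exists_walk ha hb
  have hwl : w.length + 1 = l.length := by rw [← hw, SimpleGraph.Walk.length_support]
  have hsupp : (SimpleGraph.Walk.cons hva (w.concat hvb.symm)).support = v :: (l ++ [v]) := by
    rw [SimpleGraph.Walk.support_cons, SimpleGraph.Walk.support_concat, hw]
  have hab : a ≠ b := by
    rintro rfl
    have : w.IsPath := (SimpleGraph.Walk.isPath_def w).2 (hw ▸ hl.nodup)
    have := SimpleGraph.Walk.length_eq_zero_iff.2 (SimpleGraph.Walk.isPath_iff_nil.1 this)
    omega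
  have hedges : ∀ e ∈ w.edges, e ∈ (SimpleGraph.Walk.cons hva (w.concat hvb.symm)).edges := by
    intro e he
    rw [SimpleGraph.Walk.edges_cons, SimpleGraph.Walk.edges_concat]
    simp [he]
  refine ⟨.cons hva (w.concat hvb.symm), ⟨?_, ?_, ?_⟩, ?_, ?_⟩
  · rw [SimpleGraph.Walk.cons_isCycle_iff]
    constructor
    · rw [SimpleGraph.Walk.isPath_def, SimpleGraph.Walk.support_concat, hw]
      simpa [List.nodup_append, hl.nodup] using fun x (hx : x ∈ l) (h : x = v) => hv (h ▸ hx)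
    · rw [SimpleGraph.Walk.edges_concat]
      intro h
      simp only [List.concat_eq_append, List.mem_append, List.mem_singleton] at h
      rcases h with h | h
      · exact hv (hw ▸ w.fst_mem_support_of_mem_edges h)
      · simp only [Sym2.eq_iff] at h
        rcases h with ⟨h1, h2⟩ | ⟨-, h2⟩
        · exact hab (h2.trans h1)
        · exact hab h2
  · intro x hx y hy hxy
    rw [SimpleGraph.Walk.mem_verts_toSubgraph, hsupp] at hx hy
    rw [SimpleGraph.Walk.adj_toSubgraph_iff_mem_edges]
    have hx' : x = v ∨ x ∈ l := by simpa [or_comm, or_assoc] using hx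
    have hy' : y = v ∨ y ∈ l := by simpa [or_comm, or_assoc] using hy
    have key : ∀ y ∈ l, G.Adj v y →
        s(v, y) ∈ (SimpleGraph.Walk.cons hva (w.concat hvb.symm)).edges := by
      intro y hy hvy
      rw [SimpleGraph.Walk.edges_cons, SimpleGraph.Walk.edges_concat]
      rcases hvl y hy hvy with rfl | rfl
      · simp
      · simp
    rcases hx' with rfl | hx' <;> rcases hy' with rfl | hy'
    · exact absurd hxy (G.loopless.irrefl _)
    · exact key y hy' hxy
    · rw [Sym2.eq_swap]; exact key x hx' hxy.symm
    · exact hedges _ (hE x hx' y hy' hxy)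
  · simp; omega
  · simp; omega
  · intro x hx
    rw [hsupp] at hx
    simpa [or_comm, or_assoc] using hx

/-! ### Chains and how they close up -/

/-- A family of induced paths from `b₀` to the vertices `b ∈ B`, all avoiding `X` before their last
vertex, that will be used to close paths starting at the neighbour `z₀` of `b₀`. -/
structure Closing (G : SimpleGraph V) (z₀ b₀ : V) (σ : V → List V) (X B : Set V) : Prop where
  adj : G.Adj b₀ z₀
  path : ∀ b ∈ B, IsInducedPath G (b₀ :: (σ b ++ [b]))
  notMem : ∀ b ∈ B, b ∉ X
  far : ∀ b ∈ B, ∀ y ∈ b₀ :: σ b, ∀ x ∈ X, y ≠ x ∧ ¬ G.Adj y x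
  sep : ∀ b ∈ B, ∀ b' ∈ B, b' ∉ closedBall G 2 b → ∀ y ∈ b₀ :: σ b, y ≠ b' ∧ ¬ G.Adj y b'

theorem Closing.mono {G : SimpleGraph V} {z₀ b₀ : V} {σ : V → List V} {X B X' B' : Set V}
    (h : Closing G z₀ b₀ σ X B) (hX : X' ⊆ X) (hB : B' ⊆ B) : Closing G z₀ b₀ σ X' B' :=
  ⟨h.adj, fun b hb => h.path b (hB hb), fun b hb hx => h.notMem b (hB hb) (hX hx),
    fun b hb y hy x hx => h.far b (hB hb) y hy x (hX hx),
    fun b hb b' hb' => h.sep b (hB hb) b' (hB hb')⟩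

theorem Closing.ne {G : SimpleGraph V} {z₀ b₀ : V} {σ : V → List V} {X B : Set V}
    (h : Closing G z₀ b₀ σ X B) {b : V} (hb : b ∈ B) : b ≠ b₀ := by
  rintro rfl
  exact (h.path b hb).2.1 (by simp)

/-- Induced paths from `z` to `z₀` inside `P`, whose lengths take `t + 1` consecutive values
modulo `ℓ`, with a connected set `X` attached at `z` and a set `B`, covering most of `X`, from which
the paths can be closed. -/
structure Chain (G : SimpleGraph V) (ℓ K t : ℕ) (z₀ b₀ : V) (σ : V → List V) (z : V)
    (X B P : Set V) : Prop where
  paths : ∀ j ≤ t, ∃ l, IsInducedPath G (z :: l) ∧ (z :: l).getLast? = some z₀ ∧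
    (∀ x ∈ z :: l, x ∈ P) ∧ l.length ≡ K + j [MOD ℓ]
  conn : ConnectedOn G X
  attached : ∃ x ∈ X, G.Adj z x
  disjoint : ∀ x ∈ X, x ∉ P
  far : ∀ p ∈ P, p ≠ z → ∀ x ∈ X, ¬ G.Adj p x
  cover : ∀ x ∈ X, x ∉ closedBall G 5 z → ∃ b ∈ B, G.Adj b x
  closing : Closing G z₀ b₀ σ X B
  clean : ∀ b ∈ B, ∀ y ∈ b₀ :: (σ b ++ [b]), ∀ p ∈ P, y ≠ p ∧ (G.Adj y p → y = b₀ ∧ p = z₀)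

namespace Chain

variable {G : SimpleGraph V} {ℓ K t : ℕ} {z₀ b₀ z : V} {σ : V → List V} {X B P : Set V}

theorem mem (h : Chain G ℓ K t z₀ b₀ σ z X B P) : z ∈ P := by
  obtain ⟨l, -, -, hl, -⟩ := h.paths 0 (Nat.zero_le _)
  exact hl z List.mem_cons_self

theorem clean' (h : Chain G ℓ K t z₀ b₀ σ z X B P) {b : V} (hb : b ∈ B) {p : V} (hp : p ∈ P) :
    b ≠ p ∧ ¬ G.Adj b p := by
  have := h.clean b hb b (by simp) p hp
  exact ⟨this.1, fun h' => h.closing.ne hb (this.2 h').1⟩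

/-- Extending a chain by a pair of paths whose lengths differ by one. -/
theorem extend (h : Chain G ℓ K t z₀ b₀ σ z X B P) {X' B' D : Set V} {u v : V} {gu gv : List V}
    {α : ℕ} (hX'X : X' ⊆ X) (hX' : ConnectedOn G X') (hB'B : B' ⊆ B)
    (hu : IsInducedPath G (v :: u :: (gu ++ [z]))) (hv : IsInducedPath G (v :: (gv ++ [z])))
    (huD : ∀ y ∈ v :: u :: gu, y ∈ D) (hvD : ∀ y ∈ v :: gv, y ∈ D)
    (hD : ∀ y ∈ D, y ∈ X ∨ y ∈ B) (hDX' : ∀ y ∈ D, y ∉ X' ∧ (y ≠ v → ∀ x ∈ X', ¬ G.Adj y x))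
    (hvX' : ∃ x ∈ X', G.Adj v x) (hzX' : ∀ x ∈ X', ¬ G.Adj z x)
    (hDB' : ∀ b ∈ B', ∀ y ∈ D, y ≠ b ∧ ¬ G.Adj y b ∧ (y ∈ B → y ∉ closedBall G 2 b))
    (hcover : ∀ x ∈ X', x ∉ closedBall G 5 v → ∃ b ∈ B', G.Adj b x)
    (huα : gu.length + 1 ≡ α [MOD ℓ]) (hvα : gv.length + 1 ≡ α [MOD ℓ]) :
    Chain G ℓ (K + α) (t + 1) z₀ b₀ σ v X' B' (P ∪ D) := by
  have hDP : ∀ y ∈ D, ∀ p ∈ P, p ≠ z → y ≠ p ∧ ¬ G.Adj y p := by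
    intro y hy p hp hpz
    rcases hD y hy with hyX | hyB
    · exact ⟨fun he => h.disjoint y hyX (he ▸ hp), fun ha => h.far p hp hpz y hyX ha.symm⟩
    · exact h.clean' hyB hp
  have key : ∀ g : List V, IsInducedPath G (v :: (g ++ [z])) → (∀ y ∈ v :: g, y ∈ D) →
      ∀ j ≤ t, ∀ k, g.length + 1 + j ≡ α + k [MOD ℓ] →
      ∃ l, IsInducedPath G (v :: l) ∧ (v :: l).getLast? = some z₀ ∧
        (∀ x ∈ v :: l, x ∈ P ∪ D) ∧ l.length ≡ K + α + k [MOD ℓ] := by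
    intro g hg hgD j hj k hk
    obtain ⟨l, hl, hlast, hlP, hlen⟩ := h.paths j hj
    refine ⟨g ++ z :: l, IsInducedPath.append (g := v :: g) hg hl fun x hx y hy =>
      hDP x (hgD x hx) y (hlP y (List.mem_cons_of_mem _ hy)) fun he => hl.2.1 (he ▸ hy), ?_, ?_, ?_⟩
    · rw [← List.cons_append, List.getLast?_append, hlast]; rfl
    · intro x hx
      rw [← List.cons_append] at hx
      rcases List.mem_append.1 hx with hx | hx
      · exact Or.inr (hgD x hx)
      · exact Or.inl (hlP x hx)
    · rw [List.length_append, List.length_cons]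
      calc g.length + (l.length + 1) = l.length + (g.length + 1) := by ring
        _ ≡ K + j + (g.length + 1) [MOD ℓ] := hlen.add_right _
        _ = K + (g.length + 1 + j) := by ring
        _ ≡ K + (α + k) [MOD ℓ] := hk.add_left _
        _ = K + α + k := by ring
  refine ⟨fun j hj => ?_, hX', hvX', fun x hx hxPD => ?_, fun p hp hpv x hx => ?_, hcover,
    h.closing.mono hX'X hB'B, fun b hb y hy p hp => ?_⟩
  -- The route through `u`, longer by one modulo `ℓ`, serves only the new top value `t + 1`; the
  -- route through `v` alone shifts all the old values.
  · rcases Nat.lt_or_ge t j with htj | hjt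
    · obtain rfl : j = t + 1 := by omega
      refine key (u :: gu) hu huD t le_rfl (t + 1) ?_
      rw [List.length_cons]
      calc gu.length + 1 + 1 + t = gu.length + 1 + (t + 1) := by ring
        _ ≡ α + (t + 1) [MOD ℓ] := huα.add_right _
    · exact key gv hv hvD j hjt j (hvα.add_right _)
  · rcases hxPD with hxP | hxD
    · exact h.disjoint x (hX'X hx) hxP
    · exact (hDX' x hxD).1 hx
  · rcases hp with hp | hp
    · by_cases hpz : p = z
      · exact hpz ▸ hzX' x hx
      · exact h.far p hp hpz x (hX'X hx)
    · exact (hDX' p hp).2 hpv x hx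
  · rcases hp with hp | hp
    · exact h.clean b (hB'B hb) y hy p hp
    · have hyp : y ≠ p ∧ ¬ G.Adj y p := by
        have hbp := hDB' b hb p hp
        have hy' : y ∈ b₀ :: σ b ∨ y = b := by
          simpa [or_assoc] using hy
        rcases hy' with hy' | rfl
        · rcases hD p hp with hpX | hpB
          · exact h.closing.far b (hB'B hb) y hy' p hpX
          · exact h.closing.sep b (hB'B hb) p hpB (hbp.2.2 hpB) y hy'
        · exact ⟨hbp.1.symm, fun ha => hbp.2.1 ha.symm⟩
      exact ⟨hyp.1, fun ha => absurd ha hyp.2⟩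

/-- A chain whose lengths take all values modulo `ℓ` gives peripheral holes of all lengths. -/
theorem exists_isHole [Finite V] (h : Chain G ℓ K t z₀ b₀ σ z X B P) (hℓ : 0 < ℓ) (ht : ℓ ≤ t + 1) {τ d : ℕ}
    (hτ : localChromaticNumber G 8 ≤ τ) (hX : ¬ ColorableOn G X (d + τ)) (r : ℕ) :
    ∃ (v : V) (H : G.Walk v v), IsHole H ∧ IsPeripheral d H ∧ H.length ≡ r [MOD ℓ] := by
  obtain ⟨x₁, hx₁, hzx₁⟩ := h.attached
  obtain ⟨lev, hlev⟩ := (h.conn.insert hx₁ hzx₁).exists_isLevel (Set.mem_insert z X)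
  have hball : ∀ n ≤ 8, ¬ ColorableOn G (X \ closedBall G n z) d := fun n hn hcol =>
    hX (ColorableOn.of_diff (colorableOn_closedBall hτ hn z) hcol)
  let T : Set V := {x ∈ X | x ∉ closedBall G 5 z}
  have hT : T.Nonempty := nonempty_of_not_colorableOn (hball 5 (by norm_num))
  -- With `x` of least level outside the 5-ball, the geodesic from `x` to `z` stays in the 6-ball
  -- and the cover `b` of `x` in the 7-ball.
  obtain ⟨x, ⟨hx, hx5⟩, hmin⟩ := Set.exists_min_image T lev (Set.toFinite T) hT
  have hlt : ∀ y ∈ insert z X, lev y < lev x → y ∈ closedBall G 5 z := by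
    rintro y (rfl | hy) hyx
    · exact mem_closedBall_self _ _
    · by_contra hy5
      exact absurd (hmin y ⟨hy, hy5⟩) (by omega)
  have hxz : x ≠ z := fun he => hx5 (he ▸ mem_closedBall_self _ _)
  have hx6 : x ∈ closedBall G 6 z := by
    obtain ⟨n, hn⟩ := Nat.exists_eq_succ_of_ne_zero
      (fun h0 => hxz ((hlev.root x (Or.inr hx)).1 h0))
    obtain ⟨w, hw, hwn, hxw⟩ := hlev.pred x (Or.inr hx) n hn
    exact mem_closedBall_of_adj (hlt w hw (by omega)) hxw.symm
  obtain ⟨g, hg, hhead, -, hgmem⟩ := hlev.exists_geodesic (lev x) x (Or.inr hx) rfl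
  have hgX : ∀ y ∈ g, y ∈ X ∧ y ∈ closedBall G 6 z := by
    intro y hy
    obtain ⟨h1, h2, h3, h4, -⟩ := hgmem y hy
    constructor
    · rcases h1 with rfl | h1
      · have := (hlev.root y hlev.mem).2 rfl
        omega
      · exact h1
    · rcases h3.lt_or_eq with h3 | h3
      · exact closedBall_mono (by norm_num) z (hlt y h1 h3)
      · exact h4 h3 ▸ hx6
  obtain ⟨b, hb, hbx⟩ := h.cover x hx hx5
  have hb7 : b ∈ closedBall G 7 z := mem_closedBall_of_adj hx6 hbx.symm
  have hbz := h.clean' hb h.mem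
  -- `b` may have several neighbours on the geodesic, so the path is shortcut at the last one.
  obtain ⟨L, hL, hLsuf, hbL⟩ := hg.cons_suffix (a := b) (by
    intro hbg
    rcases List.mem_append.1 hbg with hbg | hbg
    · exact h.closing.notMem b hb (hgX b hbg).1
    · exact hbz.1 (by simpa using hbg)) ⟨x, List.mem_of_mem_head? (by rw [hhead]; rfl), hbx⟩
  obtain ⟨g', hg'suf, rfl⟩ := exists_eq_append_singleton_of_suffix hL hLsuf
  have hg'X : ∀ y ∈ g', y ∈ X ∧ y ∈ closedBall G 6 z := fun y hy => hgX y (hg'suf.subset hy)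
  have hg' : g' ≠ [] := by
    rintro rfl
    exact hbz.2 ((hbL.2.2 z (by simp)).2 rfl)
  -- The `3` counts `b₀`, `b` and `z`. Since `b` and `g'` do not depend on `j`, any residue can be
  -- reached.
  obtain ⟨j, hj, hjr⟩ : ∃ j ≤ t, (σ b).length + g'.length + K + 3 + j ≡ r [MOD ℓ] := by
    let N := (σ b).length + g'.length + K + 3
    refine ⟨(r + (ℓ - N % ℓ)) % ℓ, ?_, ?_⟩
    · have := Nat.mod_lt (r + (ℓ - N % ℓ)) hℓ
      omega
    · have h1 := Nat.mod_lt N hℓ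
      calc N + (r + (ℓ - N % ℓ)) % ℓ ≡ N % ℓ + (r + (ℓ - N % ℓ)) [MOD ℓ] :=
            Nat.ModEq.add (Nat.mod_modEq _ _).symm (Nat.mod_modEq _ _)
        _ = r + ℓ := by omega
        _ ≡ r [MOD ℓ] := by simp [Nat.ModEq]
  obtain ⟨l, hl, hlast, hlP, hlen⟩ := h.paths j hj
  have hlP' : ∀ y ∈ l, y ∈ P ∧ y ≠ z := fun y hy =>
    ⟨hlP y (List.mem_cons_of_mem _ hy), fun he => hl.2.1 (he ▸ hy)⟩
  have hσ := h.closing.path b hb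
  have h1 : IsInducedPath G (b :: (g' ++ z :: l)) := IsInducedPath.append (g := b :: g') hbL hl (by
    intro y hy p hp
    rcases List.mem_cons.1 hy with rfl | hy
    · exact h.clean' hb (hlP' p hp).1
    · exact ⟨fun he => h.disjoint y (hg'X y hy).1 (he ▸ (hlP' p hp).1), fun ha =>
        h.far p (hlP' p hp).1 (hlP' p hp).2 y (hg'X y hy).1 ha.symm⟩)
  have h2 : IsInducedPath G (σ b ++ b :: (g' ++ z :: l)) := IsInducedPath.append hσ.1 h1 (by
    intro y hy p hp
    rcases List.mem_append.1 hp with hp | hp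
    · exact h.closing.far b hb y (List.mem_cons_of_mem _ hy) p (hg'X p hp).1
    · have := h.clean b hb y (by simp [hy]) p (hlP p hp)
      refine ⟨this.1, fun ha => hσ.2.1 ?_⟩
      rw [← (this.2 ha).1]
      exact List.mem_append_left _ hy)
  have hbg : ∀ y ∈ g' , b₀ ≠ y ∧ ¬ G.Adj b₀ y := fun y hy =>
    h.closing.far b hb b₀ List.mem_cons_self y (hg'X y hy).1
  have hbl : ∀ y ∈ z :: l , b₀ ≠ y ∧ (G.Adj b₀ y → y = z₀) := fun y hy =>
    ⟨(h.clean b hb b₀ List.mem_cons_self y (hlP y hy)).1, fun ha =>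
      ((h.clean b hb b₀ List.mem_cons_self y (hlP y hy)).2 ha).2⟩
  obtain ⟨a, ha⟩ : ∃ a, (σ b ++ [b]).head? = some a := by
    cases σ b <;> simp
  have ha' : (σ b ++ b :: (g' ++ z :: l)).head? = some a := by
    rw [← ha]
    cases σ b <;> simp
  have hmem : ∀ y ∈ σ b ++ b :: (g' ++ z :: l), y ∈ σ b ++ [b] ∨ y ∈ g' ∨ y ∈ z :: l := by
    intro y hy
    simp only [List.mem_append, List.mem_cons, List.not_mem_nil] at hy ⊢
    tauto
  obtain ⟨H, hH, hHlen, hHsupp⟩ := h2.exists_isHole (a := a) (b := z₀) (v := b₀) ha'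
    (by rw [← List.cons_append, ← List.append_assoc, List.getLast?_append, hlast]; rfl)
    (by
      have := List.length_pos_iff.2 hg'
      simp only [List.length_append, List.length_cons]
      omega)
    (by
      intro hy
      rcases hmem b₀ hy with hy | hy | hy
      · exact hσ.2.1 hy
      · exact (hbg b₀ hy).1 rfl
      · exact (hbl b₀ hy).1 rfl)
    ((hσ.2.2 a (List.mem_of_mem_head? (by rw [ha]; rfl))).2 ha) h.closing.adj
    (by
      intro y hy hadj
      rcases hmem y hy with hy | hy | hy
      · have := (hσ.2.2 y hy).1 hadj
        rw [ha, Option.some.injEq] at this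
        exact Or.inl this.symm
      · exact absurd hadj (hbg y hy).2
      · exact Or.inr ((hbl y hy).2 hadj))
  refine ⟨b₀, H, hH, ?_, ?_⟩
  · refine not_colorableOn_iff.1 fun hcol => hball 8 le_rfl (hcol.mono ?_ le_rfl)
    rintro x' ⟨hx', hx'8⟩
    have key : ∀ y ∈ H.support, y ≠ x' ∧ ¬ G.Adj y x' := by
      intro y hy
      have hsupp : y ∈ b₀ :: σ b ∨ y = b ∨ y ∈ g' ∨ y ∈ z :: l := by
        rcases hHsupp y hy with rfl | hy
        · exact Or.inl List.mem_cons_self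
        · simp only [List.mem_append, List.mem_cons] at hy ⊢
          tauto
      have hnear : ∀ n ≤ 7, y ∈ closedBall G n z → y ≠ x' ∧ ¬ G.Adj y x' := fun n hn hyn =>
        ⟨fun he => hx'8 (closedBall_mono (by omega) z (he ▸ hyn)), fun ha =>
          hx'8 (closedBall_mono (by omega) z (mem_closedBall_of_adj hyn ha))⟩
      rcases hsupp with hy | rfl | hy | hy
      · exact h.closing.far b hb y hy x' hx'
      · exact hnear 7 le_rfl hb7
      · exact hnear 6 (by norm_num) (hg'X y hy).2
      · rcases List.mem_cons.1 hy with rfl | hy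
        · exact hnear 0 (by norm_num) (mem_closedBall_self _ _)
        · exact ⟨fun he => h.disjoint x' hx' (he ▸ (hlP' y hy).1),
            h.far y (hlP' y hy).1 (hlP' y hy).2 x' hx'⟩
    exact ⟨fun hs => (key x' hs).1 rfl, fun y hy ha => (key y hy).2 ha.symm⟩
  · rw [hHlen, List.length_append, List.length_cons, List.length_append, List.length_cons]
    calc (σ b).length + (g'.length + (l.length + 1) + 1) + 1
        = (σ b).length + g'.length + 3 + l.length := by ring
      _ ≡ (σ b).length + g'.length + 3 + (K + j) [MOD ℓ] := hlen.add_left _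
      _ = (σ b).length + g'.length + K + 3 + j := by ring
      _ ≡ r [MOD ℓ] := hjr

end Chain

/-! ### The initial chain -/

theorem IsInducedPath.cons {G : SimpleGraph V} {l : List V} {a p : V} (hl : IsInducedPath G l)
    (hp : l.head? = some p) (hap : G.Adj a p)
    (h : ∀ x ∈ l, a ≠ x ∧ (G.Adj a x → x = p)) : IsInducedPath G (a :: l) := by
  refine ⟨hl, fun ha => (h a ha).1 rfl, fun x hx => ?_⟩
  rw [hp, Option.some.injEq]
  exact ⟨fun hax => ((h x hx).2 hax).symm, fun he => he ▸ hap⟩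

theorem IsInducedPath.connectedOn {G : SimpleGraph V} {l : List V} (hl : IsInducedPath G l)
    (hne : l ≠ []) : ConnectedOn G {x | x ∈ l} := by
  induction l with
  | nil => exact absurd rfl hne
  | cons a l ih =>
    rcases l with _ | ⟨b, l⟩
    · simpa using ConnectedOn.singleton a
    · have := (ih hl.1 (by simp)).insert (v := a) (x := b) (by simp)
        ((hl.2.2 b List.mem_cons_self).2 rfl)
      convert this using 1
      ext x
      simp

theorem mem_closedBall_trans {G : SimpleGraph V} {m n : ℕ} {v x y : V}
    (hx : y ∈ closedBall G m v) (hy : y ∈ closedBall G n x) : x ∈ closedBall G (m + n) v := by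
  simp only [closedBall, Set.mem_ofPred_eq] at *
  calc G.edist v x ≤ G.edist v y + G.edist y x := SimpleGraph.edist_triangle
    _ ≤ m + n := add_le_add hx (by rwa [SimpleGraph.edist_comm])
    _ = _ := by push_cast; rfl

theorem colorableOn_neighborSet {G : SimpleGraph V} {τ : ℕ} (h : localChromaticNumber G 8 ≤ τ)
    (v : V) : ColorableOn G (G.neighborSet v) τ :=
  (colorableOn_closedBall h (n := 1) (by norm_num) v).mono
    (fun _ hx => mem_closedBall_of_adj (mem_closedBall_self 0 v) hx) le_rfl

/-- Large graphs contain a chain with a single path. -/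
theorem exists_chain_zero [Finite V] {G : SimpleGraph V} {τ c : ℕ} (ℓ : ℕ)
    (hτ : localChromaticNumber G 8 ≤ τ) (hG : ¬ ColorableOn G Set.univ (2 * (c + τ))) :
    ∃ z₀ b₀ σ z X B P, Chain G ℓ 0 0 z₀ b₀ σ z X B P ∧ ¬ ColorableOn G X c := by
  obtain ⟨C₀, -, hC₀, hC₀c, -⟩ := exists_component hG
  obtain ⟨r, hr⟩ := hC₀.1
  obtain ⟨lev, hlev⟩ := hC₀.exists_isLevel hr
  obtain ⟨k, hk⟩ := hlev.exists_not_colorableOn subset_rfl hC₀c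
  have hk8 : 8 < k := by
    by_contra hk8
    exact hk ((colorableOn_closedBall hτ le_rfl r).mono (fun x hx =>
      closedBall_mono (by omega) r (hlev.mem_closedBall k x hx.1 hx.2)) (by omega))
  obtain ⟨n, rfl⟩ : ∃ n, k = n + 2 := ⟨k - 2, by omega⟩
  obtain ⟨C, hCL, hC, hCc, -⟩ := exists_component hk
  obtain ⟨c₁, hc₁⟩ := hC.1
  obtain ⟨b₀, hb₀, hb₀n, hcb₀⟩ := hlev.pred c₁ (hCL hc₁).1 (n + 1) (hCL hc₁).2
  have hCN : ¬ ColorableOn G (C \ G.neighborSet b₀) c := fun h =>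
    hCc (ColorableOn.of_diff (colorableOn_neighborSet hτ b₀) h)
  obtain ⟨X, hXC, hX, hXc, hXcl⟩ := exists_component hCN
  obtain ⟨x₀, hx₀, z₀, hz₀, hz₀X, hxz₀⟩ := hC.exists_adj (fun x hx => (hXC hx).1) hX.1
    (fun h => (hXC (h hc₁)).2 hcb₀.symm)
  have hbz₀ : G.Adj b₀ z₀ := by
    by_contra hcon
    exact hz₀X (hXcl x₀ hx₀ z₀ ⟨hz₀, hcon⟩ hxz₀)
  -- Radius 3 keeps `B` away from the neighbours of `b₀` that the return paths may use, since those
  -- lie in the 2-ball about `z₀`.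
  let B : Set V := {b | b ∈ C₀ ∧ lev b = n + 1 ∧ b ∉ closedBall G 3 z₀}
  have hball₀ : b₀ ∈ closedBall G 1 z₀ :=
    mem_closedBall_of_adj (mem_closedBall_self 0 z₀) hbz₀.symm
  have hbb₀ : ∀ b ∈ B, b ≠ b₀ := fun b hb he =>
    hb.2.2 (closedBall_mono (by norm_num) z₀ (he ▸ hball₀))
  have hgeo : ∀ b ∈ C₀, lev b = n + 1 → ∃ g, IsInducedPath G (g ++ [r]) ∧ b ∈ g ++ [r] ∧
      ∀ x ∈ g ++ [r], x ∈ C₀ ∧ (x = b ∨ (lev x ≤ n ∧ (lev x = n → G.Adj x b))) := by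
    intro b hb hbn
    obtain ⟨g, hg, hhead, -, hmem⟩ := hlev.exists_geodesic (n + 1) b hb hbn
    refine ⟨g, hg, List.mem_of_mem_head? (by rw [hhead]; rfl), fun x hx => ?_⟩
    rcases List.mem_append.1 hx with hx | hx
    · obtain ⟨h1, h2, h3, h4, h5⟩ := hmem x hx
      refine ⟨h1, ?_⟩
      rcases h3.lt_or_eq with h3 | h3
      · exact Or.inr ⟨by omega, fun h => h5 (by omega)⟩
      · exact Or.inl (h4 h3)
    · obtain rfl : x = r := by simpa using hx
      have := (hlev.root x hr).2 rfl
      exact ⟨hr, Or.inr ⟨by omega, by omega⟩⟩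
  have hex : ∀ b, ∃ s, b ∈ B → IsInducedPath G (b₀ :: (s ++ [b])) ∧ ∀ y ∈ b₀ :: s, y ∈ C₀ ∧
      (y = b₀ ∨ (lev y ≤ n ∧ (lev y = n → G.Adj y b ∨ G.Adj y b₀))) := by
    intro b
    by_cases hb : b ∈ B
    swap
    · exact ⟨[], fun h => absurd h hb⟩
    obtain ⟨g, hg, hbg, hgmem⟩ := hgeo b hb.1 hb.2.1
    obtain ⟨g₀, hg₀, hbg₀, hg₀mem⟩ := hgeo b₀ hb₀ hb₀n
    -- The return path is taken inside the union of geodesics from `b` and `b₀` to the root, so its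
    -- interior lies two levels or more below `X`.
    obtain ⟨s, hs, hhead, hsT⟩ := ((hg.connectedOn (by simp)).union (hg₀.connectedOn (by simp))
      (x := r) (by simp) (by simp)).exists_isInducedPath (a := b₀) (b := b) (Or.inr hbg₀)
      (Or.inl hbg)
    rcases s with _ | ⟨a, s⟩
    · exact absurd (by simpa using hhead) (hbb₀ b hb)
    obtain rfl : a = b₀ := by simpa using hhead
    refine ⟨s, fun _ => ⟨hs, fun y hy => ?_⟩⟩
    have hyb : y ≠ b := by
      rintro rfl
      have := hs.nodup
      rw [List.nodup_append] at this
      exact this.2.2 y hy y (by simp) rfl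
    rcases hsT y (List.mem_append_left _ hy) with h | h
    · have := hgmem y h
      exact ⟨this.1, Or.inr ⟨(this.2.resolve_left hyb).1,
        fun h' => Or.inl ((this.2.resolve_left hyb).2 h')⟩⟩
    · have := hg₀mem y h
      refine ⟨this.1, this.2.imp id fun h' => ⟨h'.1, fun h'' => Or.inr (h'.2 h'')⟩⟩
  choose σ hσ using hex
  have hXlev : ∀ x ∈ X, x ∈ C₀ ∧ lev x = n + 2 := fun x hx => hCL (hXC hx).1
  have hz₀lev : z₀ ∈ C₀ ∧ lev z₀ = n + 2 := hCL hz₀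
  have hlow : ∀ y ∈ C₀, lev y ≤ n → ∀ x ∈ C₀, lev x = n + 2 → y ≠ x ∧ ¬ G.Adj y x := by
    intro y hy hyn x hx hxn
    refine ⟨fun he => ?_, fun ha => ?_⟩
    · rw [he] at hyn; omega
    · have := hlev.step y hy x hx ha
      omega
  have hclosing : Closing G z₀ b₀ σ X B := by
    refine ⟨hbz₀, fun b hb => (hσ b hb).1, fun b hb hbX => ?_, fun b hb y hy x hx => ?_,
      fun b hb b' hb' hbb' y hy => ?_⟩
    · have h1 := (hXlev b hbX).2
      have h2 := hb.2.1
      omega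
    · obtain ⟨hyC, rfl | ⟨hyn, -⟩⟩ := (hσ b hb).2 y hy
      · refine ⟨fun he => ?_, (hXC hx).2⟩
        have := (hXlev x hx).2
        rw [← he] at this
        omega
      · exact hlow y hyC hyn x (hXlev x hx).1 (hXlev x hx).2
    · obtain ⟨hyC, rfl | ⟨hyn, hyadj⟩⟩ := (hσ b hb).2 y hy
      · exact ⟨(hbb₀ b' hb').symm, fun ha => hb'.2.2
          (closedBall_mono (by norm_num) z₀ (mem_closedBall_of_adj hball₀ ha))⟩
      · refine ⟨fun he => ?_, fun ha => ?_⟩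
        · have := hb'.2.1
          rw [← he] at this
          omega
        · have h1 := hlev.step y hyC b' hb'.1 ha
          have h2 := hb'.2.1
          rcases hyadj (by omega) with h3 | h3
          · exact hbb' (mem_closedBall_of_adj
              (mem_closedBall_of_adj (mem_closedBall_self 0 b) h3.symm) ha)
          · exact hb'.2.2 (mem_closedBall_of_adj (mem_closedBall_of_adj hball₀ h3.symm) ha)
  refine ⟨z₀, b₀, σ, z₀, X, B, {z₀}, ⟨fun j hj => ?_, hX, ⟨x₀, hx₀, hxz₀.symm⟩, fun x hx he => ?_,
    fun p hp hpz => absurd hp hpz, fun x hx hx5 => ?_, hclosing, fun b hb y hy p hp => ?_⟩, hXc⟩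
  · obtain rfl : j = 0 := by omega
    exact ⟨[], ⟨trivial, by simp, by simp⟩, rfl, by simp, rfl⟩
  · exact hz₀X (he ▸ hx)
  · obtain ⟨b, hb, hbn, hxb⟩ := hlev.pred x (hXlev x hx).1 (n + 1) (hXlev x hx).2
    exact ⟨b, ⟨hb, hbn, fun hb3 => hx5 (closedBall_mono (by norm_num) z₀
      (mem_closedBall_of_adj hb3 hxb.symm))⟩, hxb.symm⟩
  · obtain rfl : p = z₀ := hp
    have hy' : y ∈ b₀ :: σ b ∨ y = b := by simpa [or_assoc] using hy
    rcases hy' with hy' | rfl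
    · obtain ⟨hyC, rfl | ⟨hyn, -⟩⟩ := (hσ b hb).2 y hy'
      · exact ⟨hbz₀.ne, fun _ => ⟨rfl, rfl⟩⟩
      · have := hlow y hyC hyn p hz₀lev.1 hz₀lev.2
        exact ⟨this.1, fun ha => absurd ha this.2⟩
    · refine ⟨fun he => hb.2.2 (he ▸ mem_closedBall_self _ _), fun ha => absurd
        (closedBall_mono (by norm_num) p (mem_closedBall_of_adj (mem_closedBall_self 0 p) ha.symm))
        hb.2.2⟩

/-! ### Extending a chain by one residue -/

namespace Chain

variable {G : SimpleGraph V} {ℓ K t : ℕ} {z₀ b₀ z : V} {σ : V → List V} {X B P : Set V}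

/-- Extending a chain through a level that is covered, via `B`, only from nearby levels. -/
theorem step_of_high [Finite V] (h : Chain G ℓ K t z₀ b₀ σ z X B P) {τ c k : ℕ}
    (hω : ∀ S : Set V, (G.induce S).cliqueNum < G.cliqueNum → (G.induce S).chromaticNumber ≤ τ)
    (hN : ∀ v, ColorableOn G (G.neighborSet v) τ) {lev height : V → ℕ}
    (hlev : IsLevel G (insert z X) z lev) (hk : 3 ≤ k)
    (hheight : ∀ b, ∀ y ∈ X, G.Adj b y → height b ≤ lev y) {F : Set V} (hFX : F ⊆ X)
    (hFk : ∀ x ∈ F, lev x = k) (hF : ∀ x ∈ F, ∃ b ∈ B, G.Adj b x ∧ k ≤ height b + 2)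
    (hFc : ¬ ColorableOn G F ((2 * (c + τ) + 1) * τ)) :
    ∃ K' z' X' B' P', Chain G ℓ K' (t + 1) z₀ b₀ σ z' X' B' P' ∧ ¬ ColorableOn G X' c := by
  obtain ⟨n, ⟨e⟩⟩ := Finite.exists_equiv_fin V
  obtain ⟨m, rfl⟩ : ∃ m, k = m + 3 := ⟨k - 3, by omega⟩
  obtain ⟨X', hX'F, u, hu, v, hv, p, hp, q, hq, hX', hX'c, hvX', huX', huv, hpu, hpv, hqv, hvx,
    hux, hord, -, -⟩ := exists_square_edge (c := c) (Q := {y | y ∈ insert z X ∧ lev y = m + 2}) hω hN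
      (rank := fun v => (e v : ℕ)) (fun a b hab => e.injective (Fin.ext hab))
      (fun x hx => by
        obtain ⟨y, hy, hyn, hxy⟩ := hlev.pred x (Or.inr (hFX hx)) (m + 2) (hFk x hx)
        exact ⟨y, ⟨hy, hyn⟩, hxy.symm⟩) hFc
  have hroute : ∀ w ∈ F, w ∈ closedBall G 1 v → ∀ p, p ∈ insert z X → lev p = m + 2 → G.Adj p w →
      ∃ g, IsInducedPath G (w :: (g ++ [z])) ∧ g.length = m + 2 ∧ (∀ y ∈ g, y ∈ X ∧ lev y ≤ m + 2 ∧
        (lev y ≤ m ∨ y ∈ closedBall G 3 v)) ∧ ∀ x ∈ F, ∀ y ∈ g ++ [z], x ≠ y ∧ (G.Adj x y → y = p) := by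
    intro w hw hwv p hp hpm hpw
    obtain ⟨g, hg, hhead, hlen, hmem⟩ := hlev.exists_geodesic (m + 2) p hp hpm
    have hz : lev z = 0 := (hlev.root z hlev.mem).2 rfl
    have hFg : ∀ x ∈ F, ∀ y ∈ g ++ [z], x ≠ y ∧ (G.Adj x y → y = p) := by
      intro x hx y hy
      have hxk := hFk x hx
      rcases List.mem_append.1 hy with hy | hy
      · obtain ⟨h1, h2, h3, h4, -⟩ := hmem y hy
        refine ⟨fun he => ?_, fun ha => h4 ?_⟩
        · rw [he] at hxk; omega
        · have := hlev.step y h1 x (Or.inr (hFX hx)) ha.symm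
          omega
      · obtain rfl : y = z := by simpa using hy
        refine ⟨fun he => ?_, fun ha => ?_⟩
        · rw [he] at hxk; omega
        · have := hlev.step y hlev.mem x (Or.inr (hFX hx)) ha.symm
          omega
    refine ⟨g, hg.cons hhead hpw.symm (hFg w hw), hlen, fun y hy => ?_, hFg⟩
    obtain ⟨h1, h2, h3, h4, h5⟩ := hmem y hy
    have hpball : p ∈ closedBall G 2 v := mem_closedBall_of_adj hwv hpw.symm
    refine ⟨h1.resolve_left fun he => ?_, h3, ?_⟩
    · rw [he] at h2; omega
    · rcases h3.lt_or_eq with h3 | h3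
      · rcases (Nat.lt_succ_iff.1 h3).lt_or_eq with h3 | h3
        · exact Or.inl (by omega)
        · exact Or.inr (mem_closedBall_of_adj hpball (h5 (by omega)).symm)
      · exact Or.inr (h4 h3 ▸ closedBall_mono (by norm_num) v hpball)
  have hvv : v ∈ closedBall G 1 v := mem_closedBall_self _ _
  have huvball : u ∈ closedBall G 1 v := mem_closedBall_of_adj (mem_closedBall_self 0 v) huv.symm
  obtain ⟨gu, hgu, hgulen, hgumem, hguF⟩ := hroute u hu huvball p hp.1 hp.2 hpu
  obtain ⟨gv, hgv, hgvlen, hgvmem, hgvF⟩ := hroute v hv hvv q hq.1 hq.2 hqv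
  have hpX' : ∀ x ∈ X', ¬ G.Adj p x := fun x hx ha => (hord x hx p hp ha).1.ne rfl
  have hqX' : ∀ x ∈ X', ¬ G.Adj q x := fun x hx ha => (hord x hx q hq ha).2.ne rfl
  have hX'X : X' ⊆ X := hX'F.trans hFX
  let D : Set V := {y | y ∈ v :: u :: gu ∨ y ∈ v :: gv}
  have hDcases : ∀ y ∈ D, y = v ∨ y = u ∨ y ∈ gu ∨ y ∈ gv := by
    intro y hy
    simp only [D, Set.mem_ofPred_eq, List.mem_cons] at hy
    tauto
  have hDX : ∀ y ∈ D, y ∈ X := by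
    intro y hy
    rcases hDcases y hy with rfl | rfl | hy | hy
    · exact hFX hv
    · exact hFX hu
    · exact (hgumem y hy).1
    · exact (hgvmem y hy).1
  have hDlev : ∀ y ∈ D, lev y ≤ m ∨ y ∈ closedBall G 3 v := by
    intro y hy
    rcases hDcases y hy with rfl | rfl | hy | hy
    · exact Or.inr (mem_closedBall_self _ _)
    · exact Or.inr (closedBall_mono (by norm_num) _ huvball)
    · exact (hgumem y hy).2.2
    · exact (hgvmem y hy).2.2
  -- Height excludes neighbours on the routes at levels up to `m`; the remaining route vertices are
  -- in the 3-ball about `v`, hence the radius 4.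
  let B' : Set V := {b | b ∈ B ∧ m + 1 ≤ height b ∧ b ∉ closedBall G 4 v}
  refine ⟨_, v, X', B', _, h.extend (D := D) (u := u) (gu := gu) (gv := gv) (α := m + 3) hX'X hX'
    (fun b hb => hb.1) (hgu.cons rfl huv.symm fun x hx => ?_) hgv (fun y hy => Or.inl hy)
    (fun y hy => Or.inr hy) (fun y hy => Or.inl (hDX y hy)) (fun y hy => ?_) hvx
    (fun x hx hzx => ?_) (fun b hb y hy => ?_) (fun x hx hx5 => ?_) (by rw [hgulen])
    (by rw [hgvlen]), hX'c⟩
  · rcases List.mem_cons.1 hx with rfl | hx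
    · exact ⟨huv.ne', fun _ => rfl⟩
    · refine ⟨(hguF v hv x hx).1, fun ha => absurd ((hguF v hv x hx).2 ha ▸ ha.symm) hpv⟩
  · rcases hDcases y hy with rfl | rfl | hy | hy
    · exact ⟨hvX', fun hne => absurd rfl hne⟩
    · exact ⟨huX', fun _ => hux⟩
    · exact ⟨fun hyX' => (hguF y (hX'F hyX') y (List.mem_append_left _ hy)).1 rfl, fun _ x hx ha =>
        hpX' x hx ((hguF x (hX'F hx) y (List.mem_append_left _ hy)).2 ha.symm ▸ ha)⟩
    · exact ⟨fun hyX' => (hgvF y (hX'F hyX') y (List.mem_append_left _ hy)).1 rfl, fun _ x hx ha =>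
        hqX' x hx ((hgvF x (hX'F hx) y (List.mem_append_left _ hy)).2 ha.symm ▸ ha)⟩
  · have h1 := hlev.step z hlev.mem x (Or.inr (hX'X hx)) hzx
    have h2 := (hlev.root z hlev.mem).2 rfl
    have h3 := hFk x (hX'F hx)
    omega
  · refine ⟨fun he => h.closing.notMem b hb.1 (he ▸ hDX y hy), fun ha => ?_,
      fun hyB => absurd (hDX y hy) (h.closing.notMem y hyB)⟩
    rcases hDlev y hy with hy' | hy'
    · have h1 := hheight b y (hDX y hy) ha.symm
      have h2 := hb.2.1
      omega
    · exact hb.2.2 (mem_closedBall_of_adj hy' ha)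
  · obtain ⟨b, hb, hbx, hbk⟩ := hF x (hX'F hx)
    exact ⟨b, ⟨hb, by omega, fun hb4 => hx5 (mem_closedBall_of_adj hb4 hbx)⟩, hbx⟩

end Chain

namespace Chain

variable {G : SimpleGraph V} {ℓ K t : ℕ} {z₀ b₀ z : V} {σ : V → List V} {X B P : Set V}

/-- Extending a chain through a level that is covered, via `B`, from distant levels. -/
theorem step_of_low [Finite V] (h : Chain G ℓ K t z₀ b₀ σ z X B P) {τ c k : ℕ}
    (hω : ∀ S : Set V, (G.induce S).cliqueNum < G.cliqueNum → (G.induce S).chromaticNumber ≤ τ)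
    (hN : ∀ v, ColorableOn G (G.neighborSet v) τ) {lev height : V → ℕ} (hℓ : 0 < ℓ)
    (hlev : IsLevel G (insert z X) z lev)
    (hheight : ∀ b, ∀ y ∈ X, G.Adj b y → height b ≤ lev y)
    (hheight' : ∀ b, ∀ y ∈ X, G.Adj b y → ∃ w ∈ X, G.Adj b w ∧ lev w = height b)
    {F : Set V} (hFX : F ⊆ X)
    (hFk : ∀ x ∈ F, lev x = k) (hF : ∀ x ∈ F, ∃ b ∈ B, G.Adj b x)
    (hF' : ∀ x ∈ F, ∀ b ∈ B, G.Adj b x → height b + 2 < k)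
    (hFc : ¬ ColorableOn G F (ℓ * ((2 * (c + τ) + 1) * τ))) :
    ∃ K' z' X' B' P', Chain G ℓ K' (t + 1) z₀ b₀ σ z' X' B' P' ∧ ¬ ColorableOn G X' c := by
  obtain ⟨n, ⟨e⟩⟩ := Finite.exists_equiv_fin V
  -- Lexicographic order, height first, ties broken arbitrarily: a later parent never has smaller
  -- height.
  let rank : V → ℕ := fun v => height v * n + e v
  have hrank : rank.Injective := by
    intro a b hab
    have h1 : ∀ v, rank v % n = e v := fun v => by
      simp only [rank, Nat.add_mod, Nat.mul_mod_left, zero_add,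
        Nat.mod_eq_of_lt (e v).2]
    exact e.injective (Fin.ext (by rw [← h1, ← h1, hab]))
  have hrank_lt : ∀ a b, rank a < rank b → height a ≤ height b := by
    intro a b hab
    by_contra! hcon
    have h1 : (height b + 1) * n ≤ height a * n := Nat.mul_le_mul_right _ hcon
    have h2 := (e b).2
    have h3 : height a * n + e a < height b * n + e b := hab
    rw [Nat.add_mul, one_mul] at h1
    omega
  have hex : ∀ x, ∃ b, x ∈ F → b ∈ B ∧ G.Adj b x ∧ ∀ b' ∈ B, G.Adj b' x → rank b ≤ rank b' := by
    intro x
    by_cases hx : x ∈ F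
    · obtain ⟨b, hb, hmin⟩ := Set.exists_min_image {b ∈ B | G.Adj b x} rank (Set.toFinite _)
        (hF x hx)
      exact ⟨b, fun _ => ⟨hb.1, hb.2, fun b' hb' hb'x => hmin b' ⟨hb', hb'x⟩⟩⟩
    · exact ⟨x, fun h => absurd h hx⟩
  choose par hpar using hex
  -- The heights of `p` and `q` may differ, so their residues are fixed in advance; this is why
  -- lengths are controlled only modulo `ℓ`.
  obtain ⟨α, hα⟩ : ∃ α, ¬ ColorableOn G {x ∈ F | height (par x) % ℓ = α} ((2 * (c + τ) + 1) * τ) := by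
    by_contra! hcon
    exact hFc (.of_fibers (fun x => height (par x) % ℓ) (fun x _ => Nat.mod_lt _ hℓ)
      fun i _ => hcon i)
  obtain ⟨X', hX'F', u, hu', v, hv', p, hp, q, hq, hX', hX'c, hvX', huX', huv, hpu, hpv, hqv, hvx,
    hux, hord, hpmin, hqmin⟩ := exists_square_edge (c := c) (Q := B) hω hN hrank
      (fun x hx => hF x hx.1) hα
  have hX'F : X' ⊆ F := fun x hx => (hX'F' hx).1
  have hu : u ∈ F := hu'.1
  have hv : v ∈ F := hv'.1
  have hparmin : ∀ w ∈ F, ∀ p ∈ B, G.Adj p w → (∀ b ∈ B, G.Adj b w → rank p ≤ rank b) →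
      par w = p := fun w hw p hp hpw hmin =>
    hrank (le_antisymm ((hpar w hw).2.2 p hp hpw) (hmin _ (hpar w hw).1 (hpar w hw).2.1))
  have hpα : height p % ℓ = α := by rw [← hparmin u hu p hp hpu hpmin]; exact hu'.2
  have hqα : height q % ℓ = α := by rw [← hparmin v hv q hq hqv hqmin]; exact hv'.2
  have hX'X : X' ⊆ X := hX'F.trans hFX
  have hpX' : ∀ x ∈ X', ¬ G.Adj p x := fun x hx ha => (hord x hx p hp ha).1.ne rfl
  have hqX' : ∀ x ∈ X', ¬ G.Adj q x := fun x hx ha => (hord x hx q hq ha).2.ne rfl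
  have hvv : v ∈ closedBall G 1 v := mem_closedBall_self _ _
  have huvball : u ∈ closedBall G 1 v := mem_closedBall_of_adj (mem_closedBall_self 0 v) huv.symm
  have hroute : ∀ w ∈ F, w ∈ closedBall G 1 v → ∀ p ∈ B, G.Adj p w →
      ∃ g, IsInducedPath G (w :: p :: (g ++ [z])) ∧ g.length = height p ∧
        (∀ y ∈ g, y ∈ X ∧ lev y ≤ height p ∧ (lev y = height p → y ∈ closedBall G 3 v)) ∧
        ∀ x ∈ F, ∀ y ∈ g ++ [z], x ≠ y ∧ ¬ G.Adj x y := by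
    intro w hw hwv p hp hpw
    -- Descending from a lowest neighbour `a` of `p` makes `a` the only neighbour of `p` on the
    -- geodesic.
    obtain ⟨a, ha, hpa, hah⟩ := hheight' p w (hFX hw) hpw
    obtain ⟨g, hg, hhead, hlen, hmem⟩ := hlev.exists_geodesic (height p) a (Or.inr ha) hah
    have hz : lev z = 0 := (hlev.root z hlev.mem).2 rfl
    have hgX : ∀ y ∈ g, y ∈ X := fun y hy => (hmem y hy).1.resolve_left fun he => by
      have := (hmem y hy).2.1
      rw [he] at this
      omega
    have hgz : ∀ y ∈ g ++ [z], y ∈ insert z X ∧ lev y ≤ height p := by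
      intro y hy
      rcases List.mem_append.1 hy with hy | hy
      · exact ⟨(hmem y hy).1, (hmem y hy).2.2.1⟩
      · obtain rfl : y = z := by simpa using hy
        exact ⟨hlev.mem, by omega⟩
    have hhk := hF' w hw p hp hpw
    have hFg : ∀ x ∈ F, ∀ y ∈ g ++ [z], x ≠ y ∧ ¬ G.Adj x y := by
      intro x hx y hy
      have hxk := hFk x hx
      obtain ⟨h1, h2⟩ := hgz y hy
      refine ⟨fun he => ?_, fun hadj => ?_⟩
      · rw [he] at hxk; omega
      · have := hlev.step y h1 x (Or.inr (hFX hx)) hadj.symm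
        omega
    refine ⟨g, (hg.cons hhead hpa fun y hy => ?_).cons rfl hpw.symm fun y hy => ?_, hlen,
      fun y hy => ⟨hgX y hy, (hmem y hy).2.2.1, fun he => ?_⟩, hFg⟩
    · rcases List.mem_append.1 hy with hy | hy
      · refine ⟨fun he => h.closing.notMem p hp (he ▸ hgX y hy), fun hadj => ?_⟩
        exact (hmem y hy).2.2.2.1 (le_antisymm (hmem y hy).2.2.1 (hheight p y (hgX y hy) hadj))
      · obtain rfl : y = z := by simpa using hy
        have := h.clean' hp h.mem
        exact ⟨this.1, fun hadj => absurd hadj this.2⟩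
    · rcases List.mem_cons.1 hy with rfl | hy
      · exact ⟨hpw.ne', fun _ => rfl⟩
      · exact ⟨(hFg w hw y hy).1, fun hadj => absurd hadj (hFg w hw y hy).2⟩
    · rw [(hmem y hy).2.2.2.1 he]
      exact mem_closedBall_of_adj (mem_closedBall_of_adj hwv hpw.symm) hpa
  obtain ⟨gu, hgu, hgulen, hgumem, hguF⟩ := hroute u hu huvball p hp hpu
  obtain ⟨gv, hgv, hgvlen, hgvmem, hgvF⟩ := hroute v hv hvv q hq hqv
  let D : Set V := {y | y ∈ v :: u :: p :: gu ∨ y ∈ v :: q :: gv}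
  have hDcases : ∀ y ∈ D, y = v ∨ y = u ∨ y = p ∨ y = q ∨ y ∈ gu ∨ y ∈ gv := by
    intro y hy
    simp only [D, Set.mem_ofPred_eq, List.mem_cons] at hy
    tauto
  -- A kept `b` can see a geodesic only in its top vertex, which is within distance 3 of `v`. Radius
  -- 4 also puts `b` at distance more than 2 from `p` and `q`, as `Closing.sep` requires.
  let B' : Set V := {b | b ∈ B ∧ height p ≤ height b ∧ height q ≤ height b ∧ b ∉ closedBall G 4 v}
  have hnear : ∀ b ∈ B', ∀ n ≤ 3, ∀ y ∈ closedBall G n v, y ≠ b ∧ ¬ G.Adj y b := fun b hb n hn y hy =>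
    ⟨fun he => hb.2.2.2 (closedBall_mono (by omega) v (he ▸ hy)), fun ha =>
      hb.2.2.2 (closedBall_mono (by omega) v (mem_closedBall_of_adj hy ha))⟩
  have hnotB : ∀ y ∈ X, y ∉ B := fun y hy hyB => h.closing.notMem y hyB hy
  have hpball : p ∈ closedBall G 2 v := mem_closedBall_of_adj huvball hpu.symm
  have hqball : q ∈ closedBall G 2 v := mem_closedBall_of_adj hvv hqv.symm
  have hgB' : ∀ g : List V, ∀ p, (∀ y ∈ g, y ∈ X ∧ lev y ≤ height p ∧
      (lev y = height p → y ∈ closedBall G 3 v)) → ∀ b ∈ B', height p ≤ height b → ∀ y ∈ g,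
      y ≠ b ∧ ¬ G.Adj y b ∧ (y ∈ B → y ∉ closedBall G 2 b) := by
    intro g p hg b hb hpb y hy
    obtain ⟨h1, h2, h3⟩ := hg y hy
    refine ⟨fun he => hnotB y h1 (he ▸ hb.1), fun ha => ?_, fun hyB => absurd hyB (hnotB y h1)⟩
    have := hheight b y h1 ha.symm
    exact (hnear b hb 3 le_rfl y (h3 (by omega))).2 ha
  have hlen : ∀ p, height p % ℓ = α → height p + 1 + 1 ≡ α + 2 [MOD ℓ] := fun p hp => by
    have : height p ≡ α [MOD ℓ] := by rw [← hp]; exact (Nat.mod_modEq _ _).symm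
    exact this.add_right 2
  refine ⟨_, v, X', B', _, h.extend (D := D) (u := u) (gu := p :: gu) (gv := q :: gv) (α := α + 2)
    hX'X hX' (fun b hb => hb.1) (hgu.cons rfl huv.symm fun x hx => ?_) hgv (fun y hy => Or.inl hy)
    (fun y hy => Or.inr hy) (fun y hy => ?_) (fun y hy => ?_) hvx
    (fun x hx hzx => ?_) (fun b hb y hy => ?_) (fun x hx hx5 => ?_)
    (by rw [List.length_cons, hgulen]; exact hlen p hpα)
    (by rw [List.length_cons, hgvlen]; exact hlen q hqα), hX'c⟩
  · rcases List.mem_cons.1 hx with rfl | hx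
    · exact ⟨huv.ne', fun _ => rfl⟩
    · rcases List.mem_cons.1 hx with rfl | hx
      · exact ⟨fun he => hnotB v (hFX hv) (he ▸ hp), fun ha => absurd ha.symm hpv⟩
      · exact ⟨(hguF v hv x hx).1, fun ha => absurd ha (hguF v hv x hx).2⟩
  · rcases hDcases y hy with rfl | rfl | rfl | rfl | hy | hy
    · exact Or.inl (hFX hv)
    · exact Or.inl (hFX hu)
    · exact Or.inr hp
    · exact Or.inr hq
    · exact Or.inl (hgumem y hy).1
    · exact Or.inl (hgvmem y hy).1
  · rcases hDcases y hy with rfl | rfl | rfl | rfl | hy | hy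
    · exact ⟨hvX', fun hne => absurd rfl hne⟩
    · exact ⟨huX', fun _ => hux⟩
    · exact ⟨fun hX => hnotB y (hX'X hX) hp, fun _ => hpX'⟩
    · exact ⟨fun hX => hnotB y (hX'X hX) hq, fun _ => hqX'⟩
    · exact ⟨fun hyX' => (hguF y (hX'F hyX') y (List.mem_append_left _ hy)).1 rfl, fun _ x hx ha =>
        (hguF x (hX'F hx) y (List.mem_append_left _ hy)).2 ha.symm⟩
    · exact ⟨fun hyX' => (hgvF y (hX'F hyX') y (List.mem_append_left _ hy)).1 rfl, fun _ x hx ha =>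
        (hgvF x (hX'F hx) y (List.mem_append_left _ hy)).2 ha.symm⟩
  · exact (hguF x (hX'F hx) z (by simp)).2 hzx.symm
  · rcases hDcases y hy with rfl | rfl | rfl | rfl | hy | hy
    · have := hnear b hb 1 (by norm_num) y hvv
      exact ⟨this.1, this.2, fun hyB => absurd hyB (hnotB y (hFX hv))⟩
    · have := hnear b hb 1 (by norm_num) y huvball
      exact ⟨this.1, this.2, fun hyB => absurd hyB (hnotB y (hFX hu))⟩
    · have := hnear b hb 2 (by norm_num) y hpball
      exact ⟨this.1, this.2, fun _ hyb => hb.2.2.2 (mem_closedBall_trans hpball hyb)⟩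
    · have := hnear b hb 2 (by norm_num) y hqball
      exact ⟨this.1, this.2, fun _ hyb => hb.2.2.2 (mem_closedBall_trans hqball hyb)⟩
    · exact hgB' gu p hgumem b hb hb.2.1 y hy
    · exact hgB' gv q hgvmem b hb hb.2.2.1 y hy
  · obtain ⟨b, hb, hbx⟩ := hF x (hX'F hx)
    have := hord x hx b hb hbx
    exact ⟨b, ⟨hb, hrank_lt _ _ this.1, hrank_lt _ _ this.2,
      fun hb4 => hx5 (mem_closedBall_of_adj hb4 hbx)⟩, hbx⟩

end Chain

/-! ### Iteration and bounds -/

/-- The chromatic number needed to extend a chain and keep chromatic number more than `c`. -/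
def stepBound (ℓ τ c : ℕ) : ℕ := 2 * (2 * (ℓ * ((2 * (c + τ) + 1) * τ)) + τ)

/-- In `stepBound` the outer factor 2 pays for passing to one level, `τ` for deleting the 5-ball
where `B` need not cover, the inner 2 for the high/low split, and `ℓ` for the residue classes of
heights. -/
theorem Chain.step [Finite V] {G : SimpleGraph V} {ℓ K t : ℕ} {z₀ b₀ z : V} {σ : V → List V}
    {X B P : Set V} (h : Chain G ℓ K t z₀ b₀ σ z X B P) {τ c : ℕ} (hℓ : 0 < ℓ)
    (hτ : localChromaticNumber G 8 ≤ τ)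
    (hω : ∀ S : Set V, (G.induce S).cliqueNum < G.cliqueNum → (G.induce S).chromaticNumber ≤ τ)
    (hX : ¬ ColorableOn G X (stepBound ℓ τ c)) :
    ∃ K' z' X' B' P', Chain G ℓ K' (t + 1) z₀ b₀ σ z' X' B' P' ∧ ¬ ColorableOn G X' c := by
  have hN := colorableOn_neighborSet hτ
  obtain ⟨x₁, hx₁, hzx₁⟩ := h.attached
  obtain ⟨lev, hlev⟩ := (h.conn.insert hx₁ hzx₁).exists_isLevel (Set.mem_insert z X)
  obtain ⟨k, hk⟩ := hlev.exists_not_colorableOn (Set.subset_insert z X) hX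
  have hk3 : 3 ≤ k := by
    by_contra hk3
    exact hk ((colorableOn_closedBall hτ (n := 3) (by norm_num) z).mono (fun x hx =>
      closedBall_mono (by omega) z (hlev.mem_closedBall k x (Or.inr hx.1) hx.2)) (by omega))
  -- The value is 0 when `b` has no neighbour in `X`, which is harmless as such a `b` has no
  -- neighbour on the parts of the routes in `X`.
  let height : V → ℕ := fun b => sInf {a | ∃ y ∈ X, lev y = a ∧ G.Adj b y}
  have hheight : ∀ b, ∀ y ∈ X, G.Adj b y → height b ≤ lev y := fun b y hy hby =>
    Nat.sInf_le (s := {a | ∃ y ∈ X, lev y = a ∧ G.Adj b y}) ⟨y, hy, rfl, hby⟩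
  have hheight' : ∀ b, ∀ y ∈ X, G.Adj b y → ∃ w ∈ X, G.Adj b w ∧ lev w = height b := by
    intro b y hy hby
    obtain ⟨w, hw, hwh, hbw⟩ := Nat.sInf_mem (s := {a | ∃ y ∈ X, lev y = a ∧ G.Adj b y})
      ⟨lev y, y, hy, rfl, hby⟩
    exact ⟨w, hw, hbw, hwh⟩
  let F : Set V := {x | x ∈ X ∧ lev x = k} \ closedBall G 5 z
  have hF : ¬ ColorableOn G F (2 * (ℓ * ((2 * (c + τ) + 1) * τ))) := fun hcol =>
    hk (ColorableOn.of_diff (colorableOn_closedBall hτ (by norm_num) z) hcol)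
  let F₁ : Set V := {x ∈ F | ∃ b ∈ B, G.Adj b x ∧ k ≤ height b + 2}
  by_cases hF₁ : ColorableOn G F₁ (ℓ * ((2 * (c + τ) + 1) * τ))
  · refine h.step_of_low (F := F \ F₁) (c := c) hω hN hℓ hlev hheight hheight'
      (fun x hx => hx.1.1.1) (fun x hx => hx.1.1.2) (fun x hx => h.cover x hx.1.1.1 hx.1.2)
      (fun x hx b hb hbx => ?_) fun hcol => hF ?_
    · by_contra hcon
      exact hx.2 ⟨hx.1, b, hb, hbx, by omega⟩
    · exact (hF₁.of_diff hcol).mono subset_rfl (by omega)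
  · exact h.step_of_high (F := F₁) (c := c) hω hN hlev hk3 hheight (fun x hx => hx.1.1.1)
      (fun x hx => hx.1.1.2) (fun x hx => hx.2)
      fun hcol => hF₁ (hcol.mono subset_rfl (Nat.le_mul_of_pos_left _ hℓ))

/-- The chromatic number needed for a chain with `t` steps and remaining chromatic number more
than `c`. -/
def chainBound (ℓ τ : ℕ) : ℕ → ℕ → ℕ
  | 0, c => 2 * (c + τ)
  | t + 1, c => chainBound ℓ τ t (stepBound ℓ τ c)

theorem exists_chain [Finite V] {G : SimpleGraph V} {ℓ τ : ℕ} (hℓ : 0 < ℓ)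
    (hτ : localChromaticNumber G 8 ≤ τ)
    (hω : ∀ S : Set V, (G.induce S).cliqueNum < G.cliqueNum → (G.induce S).chromaticNumber ≤ τ)
    (t c : ℕ) (hG : ¬ ColorableOn G Set.univ (chainBound ℓ τ t c)) :
    ∃ K z₀ b₀ σ z X B P, Chain G ℓ K t z₀ b₀ σ z X B P ∧ ¬ ColorableOn G X c := by
  induction t generalizing c with
  | zero => exact ⟨0, exists_chain_zero ℓ hτ hG⟩
  | succ t ih =>
    obtain ⟨K, z₀, b₀, σ, z, X, B, P, h, hX⟩ := ih _ hG
    obtain ⟨K', z', X', B', P', h', hX'⟩ := h.step hℓ hτ hω hX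
    exact ⟨K', z₀, b₀, σ, z', X', B', P', h', hX'⟩

end PeripheralHoles

theorem mainTheorem9 (ℓ τ d : ℕ) (hℓ : 2 ≤ ℓ) :
    ∃ c : ℕ, ∀ (V : Type u) [Finite V] (G : SimpleGraph V),
      PeripheralHoles.localChromaticNumber G 8 ≤ τ →
      (∀ S : Set V, (G.induce S).cliqueNum < G.cliqueNum → (G.induce S).chromaticNumber ≤ τ) →
      (c : ℕ∞) < G.chromaticNumber →
      ∀ r : ℕ, r < ℓ → ∃ (v : V) (H : G.Walk v v),
        PeripheralHoles.IsHole H ∧ PeripheralHoles.IsPeripheral d H ∧ H.length ≡ r [MOD ℓ] := by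
  -- `ℓ` extensions give `ℓ + 1` consecutive residues, one more than needed; the final `τ` pays for
  -- the 8-ball around the closing excursion.
  refine ⟨PeripheralHoles.chainBound ℓ τ ℓ (d + τ), fun V _ G hτ hω hc r _ => ?_⟩
  have hG : ¬ PeripheralHoles.ColorableOn G Set.univ
      (PeripheralHoles.chainBound ℓ τ ℓ (d + τ)) := by
    rintro ⟨f, hf, hfG⟩
    refine absurd (SimpleGraph.chromaticNumber_le_iff_colorable.2 ?_) (not_le.2 hc)
    exact ⟨SimpleGraph.Coloring.mk (fun x => (⟨f x, hf x trivial⟩ : Fin _)) fun {x y} hxy he =>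
      hfG x trivial y trivial hxy (congrArg Fin.val he)⟩
  obtain ⟨K, z₀, b₀, σ, z, X, B, P, h, hX⟩ :=
    PeripheralHoles.exists_chain (by omega) hτ hω ℓ (d + τ) hG
  exact h.exists_isHole (by omega) (by omega) hτ hX r
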